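/- For $\nu\in\mathbb{C}$ and $\operatorname{Re} z>0$ let $K_\nu(z)=\int_0^\infty e^{-z\cosh u}\cosh(\nu u)\,du$ be the modified Bessel (Macdonald) function, and for real $w > 0$ put $$J(z,\nu,w)=\int_0^w e^{-z\cosh u}\cosh(\nu u)\,du,$$ and, for real $x$, $$K_c(x,\nu,w)=\frac{1}{\cos(\pi\nu/2)}\int_0^w\cos(x\sinh u)\cosh(\nu u)\,du\quad(\cos(\pi\nu/2)\neq 0),$$ $$K_s(x,\nu,w)=\frac{1}{\sin(\pi\nu/2)}\int_0^w\sin(x\sinh u)\sinh(\nu u)\,du\quad(\sin(\pi\nu/2)\neq 0).$$ Let $\delta_{n,m}$ be the Kronecker symbol and $\sinh^{-1}(u)=\log\left(u+\sqrt{1+u^2}\right)$. Then, for all integers $n,m\ge 1$, the following three integrals converge absolutely and have the stated values: $$\int_0^\infty K_{in}(x)\,J(x,im,\pi)\,\frac{dx}{x}=\frac{\pi^2}{2}\,\frac{\delta_{n,m}}{n\sinh(\pi n)},$$ $$\int_0^\infty K_{in}(x)\,K_c(x,im,\pi)\,\frac{dx}{x}=\frac{\pi^2}{2}\,\frac{\delta_{n,m}}{n\sinh(\pi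 n)},$$ $$\int_0^\infty K_{i\tau}(n)\,K_s\left(m,i\tau,\sinh^{-1}(\pi)\right)\,\tau\sinh(\pi\tau)\,d\tau=\frac{\pi^2 n}{2}\,\delta_{n,m}.$$ That is, $\{K_{in}(x)\}_{n\ge1}$ is biorthogonal to each of $\{J(x,in,\pi)\}_{n\ge1}$ and $\{K_c(x,in,\pi)\}_{n\ge1}$ over $\mathbb{R}_+$ with respect to $dx/x$, and $\{K_{i\tau}(n)\}_{n\ge1}$, $\{K_s(n,i\tau,\sinh^{-1}(\pi))\}_{n\ge1}$ are biorthogonal over $\mathbb{R}_+$ with respect to $\tau\sinh(\pi\tau)\,d\tau$. -/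

import Mathlib

open MeasureTheory

noncomputable section

/-- The modified Bessel (Macdonald) function `K_ν(z)`, for `Re z > 0` and complex `ν`,
`K_ν(z) = ∫₀^∞ exp (-z cosh u) cosh (ν u) du`. -/
def macdonaldK (ν z : ℂ) : ℂ :=
  ∫ u in Set.Ioi (0 : ℝ), Complex.exp (-z * Complex.cosh (u : ℂ)) * Complex.cosh (ν * (u : ℂ))

/-- The incomplete modified Bessel function
`J(z, ν, w) = ∫₀^w exp (-z cosh u) cosh (ν u) du`. -/
def besselJInc (z ν : ℂ) (w : ℝ) : ℂ :=
  ∫ u in (0 : ℝ)..w, Complex.exp (-z * Complex.cosh (u : ℂ)) * Complex.cosh (ν * (u : ℂ))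

/-- The incomplete Bessel function
`K_c(x, ν, w) = (1 / cos (π ν / 2)) ∫₀^w cos (x sinh u) cosh (ν u) du`
(meaningful when `cos (π ν / 2) ≠ 0`). -/
def besselKc (x : ℝ) (ν : ℂ) (w : ℝ) : ℂ :=
  1 / Complex.cos (Real.pi * ν / 2) *
    ∫ u in (0 : ℝ)..w, (Real.cos (x * Real.sinh u) : ℂ) * Complex.cosh (ν * (u : ℂ))

/-- The incomplete Bessel function
`K_s(x, ν, w) = (1 / sin (π ν / 2)) ∫₀^w sin (x sinh u) sinh (ν u) du`
(meaningful when `sin (π ν / 2) ≠ 0`). -/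
def besselKs (x : ℝ) (ν : ℂ) (w : ℝ) : ℂ :=
  1 / Complex.sin (Real.pi * ν / 2) *
    ∫ u in (0 : ℝ)..w, (Real.sin (x * Real.sinh u) : ℂ) * Complex.sinh (ν * (u : ℂ))

/-- The Kronecker symbol `δ_{n,m}`. -/
def kroneckerDelta (n m : ℕ) : ℝ := if n = m then 1 else 0

end

/-! All three relations reduce to orthogonality of `sin (n u)` or `cos (n v)` on `[0, π]`, after the
inner integral has been integrated by parts.

In the first two, the boundary terms vanish because `sin (m π) = 0`, and a factor `x` comes out that
cancels `dx / x`. Fubini then leaves `∫ K_{in}(x) e^{-x cosh u} dx` or `∫ K_{in}(x) sin (x sinh u)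
dx`. Both come from `∫₀^∞ cos (τ t) / (cosh t + cosh u) dt = π sin (τ u) / (sinh (π τ) sinh u)`
(`integral_cos_div_cosh_add_cosh`): the kernel is an integral of translates of the logistic density,
whose Fourier transform `π τ / sinh (π τ)` is a Beta integral.

In the third, integration by parts absorbs `τ` and the integrand becomes `2 cosh (π τ / 2) K_{iτ}(n)
r(τ)`, where `r` is the cosine transform on `[0, arsinh π]` of `d/du sin (m sinh u)`. Formally `∫₀^∞
cosh (π τ / 2) K_{iτ}(x) cos (τ u) dτ = (π / 2) cos (x sinh u)`, and `v = sinh u` finishes. To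
justify this, the line of integration is moved to height `θ`, `|θ| < π / 2`, where Fourier inversion
is absolutely convergent, and then `θ → π / 2` by dominated convergence. The dominating function
comes from Parseval: the square integral of `e^{τ θ} K_{iτ}(x)` is `π K_0(2 x cos θ)`, which blows
up slowly enough at `θ = π / 2` to put `e^{π τ / 2} K_{iτ}(x)` in a weighted `L²`; this suffices
because `r(τ) = O(1 / τ)`. -/

noncomputable section

/-! ### Imaginary order as a real integral, and bounds for `K_0`. -/

/-- The Macdonald function of imaginary order, `K_{iτ}(x)`, as a real integral. -/
def macdonaldKIm (τ x : ℝ) : ℝ :=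
  ∫ t in Set.Ioi (0 : ℝ), Real.exp (-x * Real.cosh t) * Real.cos (τ * t)

theorem macdonaldK_I_mul (τ x : ℝ) :
    macdonaldK (Complex.I * τ) x = (macdonaldKIm τ x : ℂ) := by
  rw [macdonaldK, macdonaldKIm, ← integral_complex_ofReal]
  congr 1 with t
  push_cast
  rw [show Complex.I * τ * t = (τ * t : ℂ) * Complex.I by ring, Complex.cosh_mul_I]

theorem macdonaldKIm_neg (τ x : ℝ) : macdonaldKIm (-τ) x = macdonaldKIm τ x := by
  simp [macdonaldKIm]

theorem cosh_ge_one_add_sq (t : ℝ) : 1 + t ^ 2 / 2 ≤ Real.cosh t := by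
  rw [← Real.cosh_abs, ← sq_abs]
  have h := Real.self_le_sinh_iff.2 (show (0:ℝ) ≤ |t| / 2 by positivity)
  have h2 := Real.cosh_two_mul (|t| / 2)
  have h3 := Real.cosh_sq (|t| / 2)
  rw [show 2 * (|t| / 2) = |t| by ring] at h2
  have : (|t| / 2) ^ 2 ≤ Real.sinh (|t| / 2) ^ 2 := by gcongr
  nlinarith

theorem integrable_exp_neg_mul_cosh {a : ℝ} (ha : 0 < a) :
    Integrable (fun t : ℝ => Real.exp (-a * Real.cosh t)) := by
  refine (integrable_exp_neg_mul_sq (show 0 < a / 2 by positivity)).mono'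
    (by fun_prop) (.of_forall fun t => ?_)
  rw [Real.norm_of_nonneg (Real.exp_pos _).le, Real.exp_le_exp]
  nlinarith [cosh_ge_one_add_sq t]

/-- Half of the exponential absorbs the factor `y`. With `y = cosh t` this dominates derivatives of
the shifted kernel. -/
theorem mul_exp_neg_mul_le {a y : ℝ} (ha : 0 < a) :
    y * Real.exp (-a * y) ≤ 2 / a * Real.exp (-(a / 2) * y) := by
  have h1 : y ≤ 2 / a * Real.exp (a / 2 * y) := by
    have := Real.add_one_le_exp (a / 2 * y)
    rw [div_mul_eq_mul_div, le_div_iff₀ ha]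
    nlinarith
  calc y * Real.exp (-a * y) ≤ 2 / a * Real.exp (a / 2 * y) * Real.exp (-a * y) := by gcongr
    _ = _ := by rw [mul_assoc, ← Real.exp_add]; ring_nf

/-- `K_0`, dominating all `K_{iτ}`. -/
def macdonaldKZero (a : ℝ) : ℝ := ∫ t in Set.Ioi (0 : ℝ), Real.exp (-a * Real.cosh t)

theorem integral_exp_neg_mul_cosh (a : ℝ) :
    ∫ t : ℝ, Real.exp (-a * Real.cosh t) = 2 * macdonaldKZero a := by
  rw [macdonaldKZero, ← integral_comp_abs (f := fun t => Real.exp (-a * Real.cosh t))]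
  simp

theorem exp_neg_le_rpow {y : ℝ} (hy : 0 < y) : Real.exp (-y) ≤ y ^ (-(1 / 4) : ℝ) := by
  rw [Real.rpow_neg hy.le, Real.exp_neg]
  gcongr
  have h1 : y ^ (1 / 4 : ℝ) ≤ (1 + y) ^ (1 / 4 : ℝ) := by gcongr; linarith
  have h2 : (1 + y) ^ (1 / 4 : ℝ) ≤ (1 + y) ^ (1 : ℝ) :=
    Real.rpow_le_rpow_of_exponent_le (by linarith) (by norm_num)
  rw [Real.rpow_one] at h2
  linarith [Real.add_one_le_exp y]

/-- Since `cosh t ≥ e^t / 2` and `e^{-y} ≤ y^{-1/4}`, the integrand is at most a constant times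
`a^{-1/4} e^{-t/4}`. The true growth at `0` is logarithmic; the exponent `1/4` is small enough for
`δ^{-1/2} δ^{-1/4}` to be integrable at `0` later. -/
theorem macdonaldKZero_le : ∃ C : ℝ, 0 < C ∧ ∀ a : ℝ, 0 < a →
    macdonaldKZero a ≤ C * a ^ (-(1 / 4) : ℝ) := by
  have hi : IntegrableOn (fun t : ℝ => Real.exp (-(1 / 4) * t)) (Set.Ioi 0) :=
    integrableOn_exp_mul_Ioi (by norm_num) 0
  refine ⟨2 ^ (1 / 4 : ℝ) * 4, by positivity, fun a ha => ?_⟩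
  have hb : ∀ t : ℝ, Real.exp (-a * Real.cosh t) ≤
      a ^ (-(1 / 4) : ℝ) * 2 ^ (1 / 4 : ℝ) * Real.exp (-(1 / 4) * t) := by
    intro t
    have hc : Real.exp t / 2 ≤ Real.cosh t := by
      rw [Real.cosh_eq]; have := Real.exp_pos (-t); linarith
    have he : 0 < a * (Real.exp t / 2) := by positivity
    calc Real.exp (-a * Real.cosh t) ≤ Real.exp (-(a * (Real.exp t / 2))) := by
          rw [neg_mul]; gcongr
      _ ≤ (a * (Real.exp t / 2)) ^ (-(1 / 4) : ℝ) := exp_neg_le_rpow he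
      _ = _ := by
          rw [Real.mul_rpow ha.le (by positivity), Real.div_rpow (by positivity) (by norm_num),
            ← Real.exp_mul, Real.rpow_neg (show (0 : ℝ) ≤ 2 by norm_num), div_inv_eq_mul]
          ring_nf
  calc macdonaldKZero a ≤ ∫ t in Set.Ioi (0 : ℝ),
        a ^ (-(1 / 4) : ℝ) * 2 ^ (1 / 4 : ℝ) * Real.exp (-(1 / 4) * t) :=
        integral_mono (integrable_exp_neg_mul_cosh ha).integrableOn (hi.const_mul _) hb
    _ = _ := by
        rw [integral_const_mul, integral_exp_mul_Ioi (by norm_num)]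
        norm_num
        ring

theorem continuous_macdonaldKIm {x : ℝ} (hx : 0 < x) :
    Continuous (fun τ => macdonaldKIm τ x) := by
  refine continuous_of_dominated (fun τ => by fun_prop) (fun τ => .of_forall fun t => ?_)
    (integrable_exp_neg_mul_cosh hx).integrableOn (.of_forall fun t => by fun_prop)
  rw [norm_mul, Real.norm_of_nonneg (Real.exp_pos _).le]
  exact mul_le_of_le_one_right (Real.exp_pos _).le (Real.abs_cos_le_one _)

theorem integral_macdonaldKIm_full (τ x : ℝ) :
    ∫ t : ℝ, Real.exp (-x * Real.cosh t) * Real.cos (τ * t) = 2 * macdonaldKIm τ x := by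
  rw [macdonaldKIm,
    ← integral_comp_abs (f := fun t => Real.exp (-x * Real.cosh t) * Real.cos (τ * t))]
  congr 1 with t
  rw [Real.cosh_abs, ← Real.cos_abs (τ * |t|), ← Real.cos_abs (τ * t), abs_mul, abs_mul, abs_abs]

/-! ### The cosine transform of `1 / (cosh t + cosh u)`. -/

/-- The derivative of the logistic sigmoid. -/
def logisticDensity (t : ℝ) : ℝ := Real.sigmoid t * (1 - Real.sigmoid t)

theorem logisticDensity_nonneg (t : ℝ) : 0 ≤ logisticDensity t :=
  mul_nonneg (Real.sigmoid_nonneg t) (by linarith [Real.sigmoid_le_one t])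

theorem continuous_logisticDensity : Continuous logisticDensity := by
  unfold logisticDensity
  have := continuous_sigmoid
  fun_prop

theorem integrable_logisticDensity : Integrable logisticDensity := by
  have h0 : IntegrableOn (fun _ : ℝ => (1 : ℝ)) (Real.sigmoid '' Set.univ) := by
    rw [Set.image_univ, Real.range_sigmoid]
    exact integrableOn_const (by simp)
  rw [integrableOn_image_iff_integrableOn_abs_deriv_smul MeasurableSet.univ
    (fun t _ => (Real.hasDerivAt_sigmoid t).hasDerivWithinAt)
    Real.sigmoid_injective.injOn, integrableOn_univ] at h0
  refine h0.congr (.of_forall fun t => ?_)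
  simp only [smul_eq_mul, mul_one]
  exact abs_of_nonneg (logisticDensity_nonneg t)

/-- The logit `log (σ / (1 - σ))` inverts the sigmoid. -/
theorem cpow_sigmoid (t : ℝ) (z : ℂ) :
    (Real.sigmoid t : ℂ) ^ z * (1 - (Real.sigmoid t : ℂ)) ^ (-z) = Complex.exp (t * z) := by
  have h0 : 0 < Real.sigmoid t := Real.sigmoid_pos t
  have h1 : 0 < 1 - Real.sigmoid t := by linarith [Real.sigmoid_lt_one t]
  rw [show (1 - (Real.sigmoid t : ℂ)) = ((1 - Real.sigmoid t : ℝ) : ℂ) by push_cast; rfl,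
    Complex.cpow_def_of_ne_zero (by exact_mod_cast h0.ne'),
    Complex.cpow_def_of_ne_zero (by exact_mod_cast h1.ne'), ← Complex.exp_add,
    ← Complex.ofReal_log h0.le, ← Complex.ofReal_log h1.le]
  congr 1
  have : Real.log (Real.sigmoid t) - Real.log (1 - Real.sigmoid t) = t := by
    rw [← Real.log_div h0.ne' h1.ne', ← Real.sigmoid_neg, ← Real.sigmoid_mul_rexp_neg,
      div_mul_cancel_left₀ h0.ne', Real.exp_neg, inv_inv, Real.log_exp]
  rw [mul_neg, ← sub_eq_add_neg, ← sub_mul]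
  congr 1
  exact_mod_cast this

/-- The characteristic function of the logistic distribution. -/
theorem integral_logisticDensity_mul_exp {τ : ℝ} (hτ : τ ≠ 0) :
    ∫ t : ℝ, (logisticDensity t : ℂ) * Complex.exp (t * (Complex.I * τ)) =
      ((Real.pi * τ / Real.sinh (Real.pi * τ) : ℝ) : ℂ) := by
  -- Substituting `x = σ(t)` maps the line onto `(0, 1)` with `dx = σ'(t) dt` and turns `e^{iτt}`
  -- into `x^{iτ} (1 - x)^{-iτ}`. The Beta integral is then evaluated by the reflection formula for
  -- `iτ Γ(iτ) Γ(1 - iτ)`.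
  have h1 : ∫ t : ℝ, (logisticDensity t : ℂ) * Complex.exp (t * (Complex.I * τ)) =
      Complex.betaIntegral (1 + Complex.I * τ) (1 - Complex.I * τ) := by
    have := integral_image_eq_integral_abs_deriv_smul MeasurableSet.univ
      (fun t _ => (Real.hasDerivAt_sigmoid t).hasDerivWithinAt) Real.sigmoid_injective.injOn
      (fun x : ℝ => (x : ℂ) ^ (Complex.I * τ) * (1 - (x : ℂ)) ^ (-(Complex.I * τ)))
    rw [Set.image_univ, Real.range_sigmoid] at this
    rw [Complex.betaIntegral, intervalIntegral.integral_of_le zero_le_one,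
      integral_Ioc_eq_integral_Ioo]
    rw [show (1 + Complex.I * τ - 1 : ℂ) = Complex.I * τ by ring,
      show (1 - Complex.I * τ - 1 : ℂ) = -(Complex.I * τ) by ring, this, setIntegral_univ]
    congr 1 with t
    rw [cpow_sigmoid, Complex.real_smul, ← logisticDensity, abs_of_nonneg (logisticDensity_nonneg t)]
  have hz : Complex.I * τ ≠ 0 := by simpa using hτ
  rw [h1, Complex.betaIntegral_eq_Gamma_mul_div _ _ (by simp) (by simp), add_comm 1,
    Complex.Gamma_add_one _ hz, show (Complex.I * τ + 1 + (1 - Complex.I * τ) : ℂ) = 2 by ring,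
    mul_assoc, Complex.Gamma_mul_Gamma_one_sub,
    show (Real.pi : ℂ) * (Complex.I * τ) = (Real.pi * τ : ℂ) * Complex.I by ring,
    Complex.sin_mul_I, show (2 : ℂ) = 1 + 1 by norm_num, Complex.Gamma_add_one _ one_ne_zero]
  have : Real.sinh (Real.pi * τ) ≠ 0 := by
    rw [Real.sinh_ne_zero]; positivity
  have h2 : Complex.sinh (Real.pi * τ) ≠ 0 := by exact_mod_cast this
  push_cast
  have := Complex.I_ne_zero
  simp
  field_simp

/-- Translation multiplies the characteristic function by `e^{-iτs}`; that function is real, so the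
real part picks out `cos (τ s)`. -/
theorem integral_logisticDensity_mul_cos {τ : ℝ} (hτ : τ ≠ 0) (s : ℝ) :
    ∫ t : ℝ, logisticDensity (t + s) * Real.cos (τ * t) =
      Real.pi * τ / Real.sinh (Real.pi * τ) * Real.cos (τ * s) := by
  have hi : Integrable fun t : ℝ =>
      (logisticDensity t : ℂ) * Complex.exp ((t - s : ℝ) * (Complex.I * τ)) := by
    refine (integrable_logisticDensity).mono' ?_ (.of_forall fun t => ?_)
    · have := continuous_logisticDensity
      fun_prop
    · rw [norm_mul, show ((t - s : ℝ) : ℂ) * (Complex.I * τ) = ((t - s) * τ : ℝ) * Complex.I by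
        push_cast; ring, Complex.norm_exp_ofReal_mul_I, mul_one, Complex.norm_real,
        Real.norm_of_nonneg (logisticDensity_nonneg t)]
  have h1 : ∫ t : ℝ, (logisticDensity t : ℂ) * Complex.exp ((t - s : ℝ) * (Complex.I * τ)) =
      ((Real.pi * τ / Real.sinh (Real.pi * τ) : ℝ) : ℂ) *
        Complex.exp ((-(τ * s) : ℝ) * Complex.I) := by
    rw [← integral_logisticDensity_mul_exp hτ, ← integral_mul_const]
    congr 1 with t
    rw [mul_assoc, ← Complex.exp_add]
    push_cast
    ring_nf
  have h2 := congrArg Complex.re h1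
  rw [← RCLike.re_eq_complex_re, ← integral_re hi] at h2
  rw [← integral_add_right_eq_self (fun t => _) (-s)]
  simp only [RCLike.re_eq_complex_re, Complex.re_ofReal_mul, Complex.exp_ofReal_mul_I_re,
    Real.cos_neg] at h2
  rw [← h2]
  congr 1 with t
  rw [show ((t - s : ℝ) : ℂ) * (Complex.I * τ) = (τ * (t - s) : ℝ) * Complex.I by
    push_cast; ring, Complex.exp_ofReal_mul_I_re]
  ring_nf

theorem sigmoid_sub_sigmoid (t u : ℝ) :
    Real.sigmoid (t + u) - Real.sigmoid (t - u) = Real.sinh u / (Real.cosh t + Real.cosh u) := by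
  have := Real.cosh_pos t
  have := Real.cosh_pos u
  rw [eq_div_iff (by positivity), Real.sigmoid_def, Real.sigmoid_def, Real.cosh_eq, Real.cosh_eq,
    Real.sinh_eq, neg_add, neg_sub, sub_eq_add_neg u t, Real.exp_add, Real.exp_add, Real.exp_neg,
    Real.exp_neg]
  have := Real.exp_pos t
  have := Real.exp_pos u
  field_simp
  ring

theorem integral_logisticDensity_shift (t u : ℝ) :
    ∫ s in (-u)..u, logisticDensity (t + s) = Real.sinh u / (Real.cosh t + Real.cosh u) := by
  rw [← sigmoid_sub_sigmoid, sub_eq_add_neg t u]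
  refine intervalIntegral.integral_eq_sub_of_hasDerivAt (f := fun s => Real.sigmoid (t + s))
    (fun s _ => (Real.hasDerivAt_sigmoid (t + s)).comp_const_add t s) ?_
  have := continuous_logisticDensity
  exact (by fun_prop : Continuous fun s => logisticDensity (t + s)).intervalIntegrable _ _

/-- The kernel times `sinh u` is the integral over `s ∈ [-u, u]` of logistic densities translated by
`s`, so Fubini reduces the transform to `∫ cos (τ s) ds` over that interval. -/
theorem integral_cos_div_cosh_add_cosh {τ u : ℝ} (hτ : τ ≠ 0) (hu : 0 < u) :
    ∫ t in Set.Ioi (0 : ℝ), Real.cos (τ * t) / (Real.cosh t + Real.cosh u) =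
      Real.pi * Real.sin (τ * u) / (Real.sinh (Real.pi * τ) * Real.sinh u) := by
  have hsu : 0 < Real.sinh u := Real.sinh_pos_iff.2 hu
  have hc := continuous_logisticDensity
  have hsw : ∫ s in (-u)..u, ∫ t : ℝ, logisticDensity (t + s) * Real.cos (τ * t) =
      ∫ t : ℝ, ∫ s in (-u)..u, logisticDensity (t + s) * Real.cos (τ * t) := by
    apply intervalIntegral_integral_swap
    refine (integrable_prod_iff (Continuous.aestronglyMeasurable ?_)).2
      ⟨.of_forall fun s => ?_, ?_⟩
    · simp only [Function.uncurry_def]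
      fun_prop
    · refine ((integrable_logisticDensity).comp_add_right s).mono' (by fun_prop)
        (.of_forall fun t => ?_)
      simp only [Function.uncurry_def]
      rw [norm_mul, Real.norm_of_nonneg (logisticDensity_nonneg _)]
      exact mul_le_of_le_one_right (logisticDensity_nonneg _) (Real.abs_cos_le_one _)
    · refine Integrable.mono'
        (intervalIntegrable_iff.1 (intervalIntegrable_const (c := ∫ t : ℝ, logisticDensity t)))
        (AEStronglyMeasurable.integral_prod_right'
          (f := fun p : ℝ × ℝ => ‖logisticDensity (p.2 + p.1) * Real.cos (τ * p.2)‖)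
          (Continuous.aestronglyMeasurable (by fun_prop))) (.of_forall fun s => ?_)
      rw [Real.norm_of_nonneg (integral_nonneg fun _ => norm_nonneg _),
        ← integral_add_right_eq_self logisticDensity s]
      refine integral_mono_of_nonneg (.of_forall fun _ => norm_nonneg _)
        ((integrable_logisticDensity).comp_add_right s) (.of_forall fun t => ?_)
      simp only [Function.uncurry_def]
      rw [norm_mul, Real.norm_of_nonneg (logisticDensity_nonneg _)]
      exact mul_le_of_le_one_right (logisticDensity_nonneg _) (Real.abs_cos_le_one _)
  simp_rw [integral_logisticDensity_mul_cos hτ, intervalIntegral.integral_mul_const,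
    integral_logisticDensity_shift, intervalIntegral.integral_const_mul] at hsw
  rw [intervalIntegral.integral_comp_mul_left _ hτ, integral_cos] at hsw
  have h2 : ∫ t : ℝ, Real.sinh u / (Real.cosh t + Real.cosh u) * Real.cos (τ * t) =
      2 * (Real.sinh u * ∫ t in Set.Ioi (0 : ℝ),
        Real.cos (τ * t) / (Real.cosh t + Real.cosh u)) := by
    rw [← integral_const_mul, ← integral_comp_abs (f := fun t => Real.sinh u *
      (Real.cos (τ * t) / (Real.cosh t + Real.cosh u)))]
    congr 1 with t
    rw [Real.cosh_abs, ← Real.cos_abs (τ * |t|), ← Real.cos_abs (τ * t), abs_mul, abs_mul,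
      abs_abs]
    ring
  rw [h2] at hsw
  have h3 : Real.sinh (Real.pi * τ) ≠ 0 := by rw [Real.sinh_ne_zero]; positivity
  rw [eq_div_iff (by positivity)]
  simp only [smul_eq_mul, mul_neg, Real.sin_neg] at hsw
  field_simp at hsw
  linarith

/-! ### Laplace and sine transforms of `x ↦ K_{iτ}(x)`. -/

/-- Integrating in `x` first leaves `1 / cosh t ≤ 2 e^{-t}`. This dominates every exchange of the
`x` integral with the one defining `K_{iτ}`. -/
theorem integrable_exp_neg_mul_cosh_prod :
    Integrable (fun p : ℝ × ℝ => Real.exp (-p.1 * Real.cosh p.2))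
      ((volume.restrict (Set.Ioi 0)).prod (volume.restrict (Set.Ioi 0))) := by
  have h1 : ∀ t x : ℝ, Real.exp (-x * Real.cosh t) = Real.exp (-Real.cosh t * x) :=
    fun t x => by ring_nf
  refine (integrable_prod_iff' (Continuous.aestronglyMeasurable (by fun_prop))).2
    ⟨.of_forall fun t => ?_, ?_⟩
  · simp_rw [h1]
    exact integrableOn_exp_mul_Ioi (by linarith [Real.cosh_pos t]) 0
  · have hi : IntegrableOn (fun t : ℝ => 2 * Real.exp (-1 * t)) (Set.Ioi 0) :=
      (integrableOn_exp_mul_Ioi (by norm_num) 0).const_mul _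
    refine Integrable.mono' hi (AEStronglyMeasurable.integral_prod_right'
      (f := fun p : ℝ × ℝ => ‖Real.exp (-p.2 * Real.cosh p.1)‖)
      (Continuous.aestronglyMeasurable (by fun_prop))) (.of_forall fun t => ?_)
    have hc := Real.cosh_pos t
    simp_rw [h1, Real.norm_eq_abs, Real.abs_exp]
    rw [integral_exp_mul_Ioi (by linarith), abs_of_nonneg (by simp; positivity)]
    simp only [mul_zero, Real.exp_zero, neg_div_neg_eq]
    rw [neg_one_mul, Real.exp_neg, div_le_iff₀ hc, Real.cosh_eq]
    have := Real.exp_pos t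
    have := Real.exp_pos (-t)
    field_simp
    linarith

theorem integrable_macdonaldKIm_kernel (τ : ℝ) {φ : ℝ → ℝ} (hφ : Continuous φ)
    (hb : ∀ x, 0 < x → |φ x| ≤ 1) :
    Integrable (fun p : ℝ × ℝ => Real.exp (-p.1 * Real.cosh p.2) * Real.cos (τ * p.2) * φ p.1)
      ((volume.restrict (Set.Ioi 0)).prod (volume.restrict (Set.Ioi 0))) := by
  refine integrable_exp_neg_mul_cosh_prod.mono' (Continuous.aestronglyMeasurable (by fun_prop)) ?_
  rw [Measure.prod_restrict]
  refine ae_restrict_of_forall_mem (measurableSet_Ioi.prod measurableSet_Ioi) fun p hp => ?_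
  rw [norm_mul, norm_mul, mul_assoc, Real.norm_of_nonneg (Real.exp_pos _).le]
  exact mul_le_of_le_one_right (Real.exp_pos _).le
    (mul_le_one₀ (Real.abs_cos_le_one _) (norm_nonneg _) (hb _ hp.1))

theorem integral_macdonaldKIm_mul (τ : ℝ) {φ : ℝ → ℝ} (hφ : Continuous φ)
    (hb : ∀ x, 0 < x → |φ x| ≤ 1) :
    ∫ x in Set.Ioi (0 : ℝ), macdonaldKIm τ x * φ x =
      ∫ t in Set.Ioi (0 : ℝ), Real.cos (τ * t) *
        ∫ x in Set.Ioi (0 : ℝ), Real.exp (-x * Real.cosh t) * φ x := by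
  simp_rw [macdonaldKIm, ← integral_mul_const]
  rw [integral_integral_swap (integrable_macdonaldKIm_kernel τ hφ hb)]
  simp_rw [← integral_const_mul]
  congr 1 with t
  congr 1 with x
  ring

theorem integrableOn_macdonaldKIm (τ : ℝ) : IntegrableOn (macdonaldKIm τ) (Set.Ioi 0) := by
  have := (integrable_macdonaldKIm_kernel τ (φ := fun _ => 1) continuous_const
    (by simp)).integral_prod_left
  simp only [mul_one] at this
  exact this

theorem integral_mul_intervalIntegral_swap {k : ℝ → ℝ} (hk : IntegrableOn k (Set.Ioi 0))
    {φ : ℝ → ℝ → ℝ} {h : ℝ → ℝ} {w : ℝ}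
    (hw : 0 ≤ w) (hφ : Continuous (Function.uncurry φ)) (hh : Continuous h)
    (hb : ∀ x u, 0 < x → |φ x u| ≤ 1) :
    IntegrableOn (fun x => k x * ∫ u in (0 : ℝ)..w, h u * φ x u) (Set.Ioi 0) ∧
    ∫ x in Set.Ioi (0 : ℝ), k x * ∫ u in (0 : ℝ)..w, h u * φ x u =
      ∫ u in (0 : ℝ)..w, h u * ∫ x in Set.Ioi (0 : ℝ), k x * φ x u := by
  have hhi : IntegrableOn h (Set.Ioc 0 w) :=
    (intervalIntegrable_iff_integrableOn_Ioc_of_le hw).1 (hh.intervalIntegrable _ _)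
  have hi : Integrable (fun p : ℝ × ℝ => k p.1 * (h p.2 * φ p.1 p.2))
      ((volume.restrict (Set.Ioi 0)).prod (volume.restrict (Set.Ioc 0 w))) := by
    refine (hk.mul_prod hhi).norm.mono' ?_ ?_
    · simp_rw [← mul_assoc]
      exact (hk.mul_prod hhi).aestronglyMeasurable.mul
        hφ.aestronglyMeasurable
    · rw [Measure.prod_restrict]
      refine ae_restrict_of_forall_mem (measurableSet_Ioi.prod measurableSet_Ioc) fun p hp => ?_
      rw [← mul_assoc, norm_mul]
      exact mul_le_of_le_one_right (norm_nonneg _) (hb _ _ hp.1)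
  simp_rw [intervalIntegral.integral_of_le hw, ← integral_const_mul]
  refine ⟨hi.integral_prod_left, ?_⟩
  rw [integral_integral_swap hi]
  congr 1 with u
  congr 1 with x
  ring

/-- After Fubini the `x` integral is elementary and yields exactly `1 / (cosh t + cosh u)`. -/
theorem integral_macdonaldKIm_mul_exp {τ u : ℝ} (hτ : τ ≠ 0) (hu : 0 < u) :
    ∫ x in Set.Ioi (0 : ℝ), macdonaldKIm τ x * Real.exp (-x * Real.cosh u) =
      Real.pi * Real.sin (τ * u) / (Real.sinh (Real.pi * τ) * Real.sinh u) := by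
  rw [integral_macdonaldKIm_mul τ (by fun_prop), ← integral_cos_div_cosh_add_cosh hτ hu]
  · congr 1 with t
    have h1 := Real.cosh_pos t
    have h2 := Real.cosh_pos u
    have : ∀ x : ℝ, Real.exp (-x * Real.cosh t) * Real.exp (-x * Real.cosh u) =
        Real.exp (-(Real.cosh t + Real.cosh u) * x) := fun x => by
      rw [← Real.exp_add]; ring_nf
    simp_rw [this]
    rw [integral_exp_mul_Ioi (by linarith)]
    rw [mul_zero, Real.exp_zero, neg_div_neg_eq, mul_one_div]
  · intro x hx
    rw [Real.abs_exp, Real.exp_le_one_iff]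
    nlinarith [Real.cosh_pos u]

theorem integral_exp_neg_mul_sin {c : ℝ} (hc : 0 < c) (s : ℝ) :
    ∫ x in Set.Ioi (0 : ℝ), Real.exp (-x * c) * Real.sin (x * s) = s / (s ^ 2 + c ^ 2) := by
  have ha : (-c + s * Complex.I : ℂ).re < 0 := by simpa using hc
  have h := integral_exp_mul_complex_Ioi ha 0
  have hi := integrableOn_exp_mul_complex_Ioi ha 0
  have h2 := congrArg Complex.im h
  rw [← RCLike.im_eq_complex_im, ← integral_im hi] at h2
  have h3 : (-Complex.exp ((-c + s * Complex.I : ℂ) * (0 : ℝ)) / (-c + s * Complex.I : ℂ)) =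
      (c + s * Complex.I) / ((s ^ 2 + c ^ 2 : ℝ) : ℂ) := by
    have h0 : (-c + s * Complex.I : ℂ) ≠ 0 := fun h => by rw [h] at ha; simp at ha
    have h1 : ((s ^ 2 + c ^ 2 : ℝ) : ℂ) ≠ 0 := by
      rw [Complex.ofReal_ne_zero]; positivity
    rw [div_eq_div_iff h0 h1]
    push_cast
    simp
    ring_nf
    rw [Complex.I_sq]
    ring
  rw [h3, RCLike.im_eq_complex_im, Complex.div_ofReal_im] at h2
  simp only [Complex.add_im, Complex.ofReal_im, Complex.mul_im, Complex.ofReal_re, Complex.I_im,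
    Complex.I_re, mul_one, mul_zero, zero_add, add_zero] at h2
  rw [← h2]
  congr 1 with x
  rw [show (-c + s * Complex.I : ℂ) * x = (-x * c : ℝ) + (x * s : ℝ) * Complex.I by
    push_cast; ring, Complex.exp_add, ← Complex.ofReal_exp,
    Complex.im_ofReal_mul, Complex.exp_ofReal_mul_I_im]

/-- Here the `x` integral gives `sinh u / (sinh² u + cosh² t)`. As `2 (sinh² u + cosh² t) = cosh 2t
+ cosh 2u`, the same cosine transform applies with `2u` and `τ / 2` in place of `u` and `τ`. -/
theorem integral_macdonaldKIm_mul_sin {τ u : ℝ} (hτ : τ ≠ 0) (hu : 0 < u) :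
    ∫ x in Set.Ioi (0 : ℝ), macdonaldKIm τ x * Real.sin (x * Real.sinh u) =
      Real.pi * Real.sin (τ * u) * Real.cosh (Real.pi * τ / 2) /
        (Real.sinh (Real.pi * τ) * Real.cosh u) := by
  rw [integral_macdonaldKIm_mul τ (by fun_prop) fun x _ => Real.abs_sin_le_one _]
  simp_rw [integral_exp_neg_mul_sin (Real.cosh_pos _)]
  have h1 : ∀ t : ℝ, Real.cos (τ * t) * (Real.sinh u / (Real.sinh u ^ 2 + Real.cosh t ^ 2)) =
      2 * Real.sinh u * (Real.cos (τ / 2 * (2 * t)) /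
        (Real.cosh (2 * t) + Real.cosh (2 * u))) := fun t => by
    have e : Real.cosh (2 * t) + Real.cosh (2 * u) =
        2 * (Real.sinh u ^ 2 + Real.cosh t ^ 2) := by
      rw [Real.cosh_two_mul, Real.cosh_two_mul, Real.sinh_sq, Real.sinh_sq]; ring
    have := Real.cosh_pos t
    have : Real.sinh u ^ 2 + Real.cosh t ^ 2 ≠ 0 := by positivity
    rw [e, show τ / 2 * (2 * t) = τ * t by ring]
    field_simp
  simp_rw [h1]
  rw [integral_const_mul, integral_comp_mul_left_Ioi
    (fun r => Real.cos (τ / 2 * r) / (Real.cosh r + Real.cosh (2 * u))) 0 two_pos, mul_zero,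
    integral_cos_div_cosh_add_cosh (div_ne_zero hτ two_ne_zero) (by positivity),
    Real.sinh_two_mul, show Real.pi * τ = 2 * (Real.pi * τ / 2) by ring, Real.sinh_two_mul]
  have h2 : Real.sinh (Real.pi * τ / 2) ≠ 0 := by rw [Real.sinh_ne_zero]; positivity
  have h3 : 0 < Real.sinh u := Real.sinh_pos_iff.2 hu
  have h4 := Real.cosh_pos u
  have h5 := Real.cosh_pos (Real.pi * τ / 2)
  rw [show τ / 2 * (2 * u) = τ * u by ring, show 2 * (Real.pi * τ / 2) / 2 = Real.pi * τ / 2 by ring,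
    show Real.pi * (τ / 2) = Real.pi * τ / 2 by ring, smul_eq_mul]
  field_simp

/-! ### Trigonometric orthogonality and integration by parts on `[0, π]`. -/

theorem integral_cos_int_mul (k : ℤ) :
    ∫ u in (0 : ℝ)..Real.pi, Real.cos (k * u) = if k = 0 then Real.pi else 0 := by
  split_ifs with h
  · simp [h]
  · have h' : (k : ℝ) ≠ 0 := by exact_mod_cast h
    rw [intervalIntegral.integral_comp_mul_left _ h', integral_cos]
    simp

theorem integral_sin_mul_sin_nat {n m : ℕ} (hn : 1 ≤ n) :
    ∫ u in (0 : ℝ)..Real.pi, Real.sin (m * u) * Real.sin (n * u) =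
      Real.pi / 2 * kroneckerDelta n m := by
  have h : ∀ u : ℝ, Real.sin (m * u) * Real.sin (n * u) =
      1 / 2 * (Real.cos (((m - n : ℤ) : ℝ) * u) - Real.cos (((m + n : ℤ) : ℝ) * u)) := fun u => by
    push_cast
    rw [sub_mul, add_mul, Real.cos_sub, Real.cos_add]; ring
  simp_rw [h]
  rw [intervalIntegral.integral_const_mul, intervalIntegral.integral_sub
    (Continuous.intervalIntegrable (by fun_prop) _ _)
    (Continuous.intervalIntegrable (by fun_prop) _ _), integral_cos_int_mul, integral_cos_int_mul,
    if_neg (show (m + n : ℤ) ≠ 0 by omega), kroneckerDelta]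
  by_cases e : n = m
  · simp [e]; ring
  · rw [if_neg (by omega), if_neg e]; simp

theorem integral_cos_mul_cos_nat {n m : ℕ} (hn : 1 ≤ n) :
    ∫ u in (0 : ℝ)..Real.pi, Real.cos (m * u) * Real.cos (n * u) =
      Real.pi / 2 * kroneckerDelta n m := by
  have h : ∀ u : ℝ, Real.cos (m * u) * Real.cos (n * u) =
      1 / 2 * (Real.cos (((m - n : ℤ) : ℝ) * u) + Real.cos (((m + n : ℤ) : ℝ) * u)) := fun u => by
    push_cast
    rw [sub_mul, add_mul, Real.cos_sub, Real.cos_add]; ring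
  simp_rw [h]
  rw [intervalIntegral.integral_const_mul, intervalIntegral.integral_add
    (Continuous.intervalIntegrable (by fun_prop) _ _)
    (Continuous.intervalIntegrable (by fun_prop) _ _), integral_cos_int_mul, integral_cos_int_mul,
    if_neg (show (m + n : ℤ) ≠ 0 by omega), kroneckerDelta]
  by_cases e : n = m
  · simp [e]; ring
  · rw [if_neg (by omega), if_neg e]; simp

/-- There is no boundary term because `sin (m u)` vanishes at `0` and `π`; this is where the upper
limit `π` matters. -/
theorem integral_mul_cos_nat {m : ℕ} (hm : 1 ≤ m) {g g' : ℝ → ℝ}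
    (hg : ∀ u, HasDerivAt g (g' u) u) (hg' : Continuous g') :
    ∫ u in (0 : ℝ)..Real.pi, g u * Real.cos (m * u) =
      -(1 / m) * ∫ u in (0 : ℝ)..Real.pi, g' u * Real.sin (m * u) := by
  have hm0 : (m : ℝ) ≠ 0 := by positivity
  have hv : ∀ u : ℝ, HasDerivAt (fun u => Real.sin (m * u) / m) (Real.cos (m * u)) u := fun u => by
    have := ((hasDerivAt_id u).const_mul (m : ℝ)).sin.div_const (m : ℝ)
    simpa [hm0] using this
  rw [intervalIntegral.integral_mul_deriv_eq_deriv_mul (fun u _ => hg u) (fun u _ => hv u)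
    (hg'.intervalIntegrable _ _) (Continuous.intervalIntegrable (by fun_prop) _ _),
    ← intervalIntegral.integral_const_mul]
  simp only [mul_zero, Real.sin_zero, zero_div, Real.sin_nat_mul_pi, sub_zero]
  rw [zero_sub, ← intervalIntegral.integral_neg]
  congr 1 with u
  ring

theorem besselJInc_I_mul (x : ℝ) (m : ℕ) :
    besselJInc x (Complex.I * m) Real.pi =
      ((∫ u in (0 : ℝ)..Real.pi, Real.exp (-x * Real.cosh u) * Real.cos (m * u) : ℝ) : ℂ) := by
  rw [besselJInc, ← intervalIntegral.integral_ofReal]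
  congr 1 with u
  push_cast
  rw [show Complex.I * m * u = (m * u : ℂ) * Complex.I by ring, Complex.cosh_mul_I]

theorem besselKc_I_mul (x : ℝ) (m : ℕ) :
    besselKc x (Complex.I * m) Real.pi =
      ((1 / Real.cosh (Real.pi * m / 2) *
        ∫ u in (0 : ℝ)..Real.pi, Real.cos (x * Real.sinh u) * Real.cos (m * u) : ℝ) : ℂ) := by
  rw [besselKc, Complex.ofReal_mul, ← intervalIntegral.integral_ofReal,
    show Real.pi * (Complex.I * m) / 2 = (Real.pi * m / 2 : ℂ) * Complex.I by ring,
    Complex.cos_mul_I]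
  push_cast
  congr 2 with u
  rw [show Complex.I * m * u = (m * u : ℂ) * Complex.I by ring, Complex.cosh_mul_I]

/-- The factor `x` extracted here cancels the singular weight `1 / x`. -/
theorem integral_exp_neg_mul_cosh_mul_cos {m : ℕ} (hm : 1 ≤ m) (x : ℝ) :
    ∫ u in (0 : ℝ)..Real.pi, Real.exp (-x * Real.cosh u) * Real.cos (m * u) =
      x * ∫ u in (0 : ℝ)..Real.pi,
        (1 / m * Real.sinh u * Real.sin (m * u)) * Real.exp (-x * Real.cosh u) := by
  rw [integral_mul_cos_nat hm (fun u => ((Real.hasDerivAt_cosh u).const_mul (-x)).exp)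
    (by fun_prop), ← intervalIntegral.integral_const_mul, ← intervalIntegral.integral_const_mul]
  congr 1 with u
  ring

theorem integral_cos_mul_sinh_mul_cos {m : ℕ} (hm : 1 ≤ m) (x : ℝ) :
    ∫ u in (0 : ℝ)..Real.pi, Real.cos (x * Real.sinh u) * Real.cos (m * u) =
      x * ∫ u in (0 : ℝ)..Real.pi,
        (1 / m * Real.cosh u * Real.sin (m * u)) * Real.sin (x * Real.sinh u) := by
  rw [integral_mul_cos_nat hm (fun u => ((Real.hasDerivAt_sinh u).const_mul x).cos)
    (by fun_prop), ← intervalIntegral.integral_const_mul, ← intervalIntegral.integral_const_mul]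
  congr 1 with u
  ring

/-! ### The biorthogonality relations with respect to `dx / x`. -/

theorem integral_macdonaldK_mul_besselJInc {n m : ℕ} (hn : 1 ≤ n) (hm : 1 ≤ m) :
    IntegrableOn (fun x : ℝ => macdonaldK (Complex.I * n) x *
          besselJInc x (Complex.I * m) Real.pi / (x : ℂ)) (Set.Ioi (0 : ℝ)) ∧
      ∫ x in Set.Ioi (0 : ℝ), macdonaldK (Complex.I * n) x *
          besselJInc x (Complex.I * m) Real.pi / (x : ℂ) =
        ((Real.pi ^ 2 / 2 * (kroneckerDelta n m / (n * Real.sinh (Real.pi * n))) : ℝ) : ℂ) := by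
  have key : ∀ x ∈ Set.Ioi (0 : ℝ), macdonaldK (Complex.I * n) x *
          besselJInc x (Complex.I * m) Real.pi / (x : ℂ) =
      ((macdonaldKIm n x * ∫ u in (0 : ℝ)..Real.pi,
        (1 / m * Real.sinh u * Real.sin (m * u)) * Real.exp (-x * Real.cosh u) : ℝ) : ℂ) := by
    intro x hx
    have hx' : (x : ℂ) ≠ 0 := by exact_mod_cast (ne_of_gt hx)
    rw [show (n : ℂ) = ((n : ℝ) : ℂ) by simp, macdonaldK_I_mul, besselJInc_I_mul,
      integral_exp_neg_mul_cosh_mul_cos hm, div_eq_iff hx']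
    push_cast
    ring
  obtain ⟨h1, h2⟩ := integral_mul_intervalIntegral_swap
    (integrableOn_macdonaldKIm n)
    (φ := fun x u => Real.exp (-x * Real.cosh u))
    (h := fun u => 1 / m * Real.sinh u * Real.sin (m * u)) Real.pi_pos.le (by fun_prop)
    (by fun_prop) (fun x u hx => by
      rw [Real.abs_exp, Real.exp_le_one_iff]
      nlinarith [Real.cosh_pos u])
  have hn0 : (n : ℝ) ≠ 0 := by positivity
  have hm0 : (m : ℝ) ≠ 0 := by positivity
  refine ⟨IntegrableOn.congr_fun h1.ofReal (fun x hx => (key x hx).symm) measurableSet_Ioi, ?_⟩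
  rw [setIntegral_congr_fun measurableSet_Ioi key, integral_complex_ofReal, h2,
    Complex.ofReal_inj]
  -- The `sinh u` from integration by parts cancels the one in the Laplace transform, leaving a pure
  -- product of sines.
  have h3 : ∀ u ∈ Set.Ioc 0 Real.pi, 1 / m * Real.sinh u * Real.sin (m * u) *
      ∫ x in Set.Ioi (0 : ℝ), macdonaldKIm n x * Real.exp (-x * Real.cosh u) =
      Real.pi / (m * Real.sinh (Real.pi * n)) * (Real.sin (m * u) * Real.sin (n * u)) := by
    intro u hu
    have := Real.sinh_pos_iff.2 hu.1
    have : Real.sinh (Real.pi * n) ≠ 0 := by rw [Real.sinh_ne_zero]; positivity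
    rw [integral_macdonaldKIm_mul_exp hn0 hu.1]
    field_simp
  rw [intervalIntegral.integral_of_le Real.pi_pos.le, setIntegral_congr_fun measurableSet_Ioc h3,
    ← intervalIntegral.integral_of_le Real.pi_pos.le, intervalIntegral.integral_const_mul,
    integral_sin_mul_sin_nat hn, kroneckerDelta]
  split_ifs with e
  · subst e
    field_simp
  · simp

theorem integral_macdonaldK_mul_besselKc {n m : ℕ} (hn : 1 ≤ n) (hm : 1 ≤ m) :
    IntegrableOn (fun x : ℝ => macdonaldK (Complex.I * n) x *
          besselKc x (Complex.I * m) Real.pi / (x : ℂ)) (Set.Ioi (0 : ℝ)) ∧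
      ∫ x in Set.Ioi (0 : ℝ), macdonaldK (Complex.I * n) x *
          besselKc x (Complex.I * m) Real.pi / (x : ℂ) =
        ((Real.pi ^ 2 / 2 * (kroneckerDelta n m / (n * Real.sinh (Real.pi * n))) : ℝ) : ℂ) := by
  have hc := Real.cosh_pos (Real.pi * m / 2)
  have key : ∀ x ∈ Set.Ioi (0 : ℝ), macdonaldK (Complex.I * n) x *
          besselKc x (Complex.I * m) Real.pi / (x : ℂ) =
      ((1 / Real.cosh (Real.pi * m / 2) * (macdonaldKIm n x * ∫ u in (0 : ℝ)..Real.pi,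
        (1 / m * Real.cosh u * Real.sin (m * u)) * Real.sin (x * Real.sinh u)) : ℝ) : ℂ) := by
    intro x hx
    have hx' : (x : ℂ) ≠ 0 := by exact_mod_cast (ne_of_gt hx)
    rw [show (n : ℂ) = ((n : ℝ) : ℂ) by simp, macdonaldK_I_mul, besselKc_I_mul,
      integral_cos_mul_sinh_mul_cos hm, div_eq_iff hx']
    push_cast
    ring
  obtain ⟨h1, h2⟩ := integral_mul_intervalIntegral_swap
    (integrableOn_macdonaldKIm n)
    (φ := fun x u => Real.sin (x * Real.sinh u))
    (h := fun u => 1 / m * Real.cosh u * Real.sin (m * u)) Real.pi_pos.le (by fun_prop)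
    (by fun_prop) (fun x u _ => Real.abs_sin_le_one _)
  have hn0 : (n : ℝ) ≠ 0 := by positivity
  have hm0 : (m : ℝ) ≠ 0 := by positivity
  refine ⟨IntegrableOn.congr_fun (h1.const_mul (1 / Real.cosh (Real.pi * m / 2))).ofReal
    (fun x hx => (key x hx).symm) measurableSet_Ioi, ?_⟩
  rw [setIntegral_congr_fun measurableSet_Ioi key, integral_complex_ofReal, integral_const_mul, h2,
    Complex.ofReal_inj]
  have h3 : ∀ u ∈ Set.Ioc 0 Real.pi, 1 / m * Real.cosh u * Real.sin (m * u) *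
      ∫ x in Set.Ioi (0 : ℝ), macdonaldKIm n x * Real.sin (x * Real.sinh u) =
      Real.pi * Real.cosh (Real.pi * n / 2) / (m * Real.sinh (Real.pi * n)) *
        (Real.sin (m * u) * Real.sin (n * u)) := by
    intro u hu
    have := Real.cosh_pos u
    have : Real.sinh (Real.pi * n) ≠ 0 := by rw [Real.sinh_ne_zero]; positivity
    rw [integral_macdonaldKIm_mul_sin hn0 hu.1]
    field_simp
  rw [intervalIntegral.integral_of_le Real.pi_pos.le, setIntegral_congr_fun measurableSet_Ioc h3,
    ← intervalIntegral.integral_of_le Real.pi_pos.le, intervalIntegral.integral_const_mul,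
    integral_sin_mul_sin_nat hn, kroneckerDelta]
  -- The factor `cosh (π n / 2)` of the sine transform cancels the normalisation `cosh (π m / 2)`
  -- only for `n = m`; otherwise both sides vanish.
  split_ifs with e
  · subst e
    field_simp
  · simp

/-! ### Shifting the line of integration, and Fourier inversion in `τ`. -/

/-- The kernel of the Macdonald function on the horizontal line of height `θ`. -/
def macdonaldWave (x θ t : ℝ) : ℂ := Complex.exp (-x * Complex.cosh (t + θ * Complex.I))

theorem macdonaldWave_eq (x θ t : ℝ) : macdonaldWave x θ t =
    (Real.exp (-(x * Real.cos θ) * Real.cosh t) : ℂ) *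
      Complex.exp ((-(x * Real.sin θ * Real.sinh t) : ℝ) * Complex.I) := by
  rw [macdonaldWave, Complex.cosh_add, Complex.cosh_mul_I, Complex.sinh_mul_I, Complex.ofReal_exp,
    ← Complex.exp_add]
  push_cast
  ring_nf

theorem norm_macdonaldWave (x θ t : ℝ) :
    ‖macdonaldWave x θ t‖ = Real.exp (-(x * Real.cos θ) * Real.cosh t) := by
  rw [macdonaldWave_eq, norm_mul, Complex.norm_exp_ofReal_mul_I, mul_one, Complex.norm_real,
    Real.norm_of_nonneg (Real.exp_pos _).le]

theorem re_macdonaldWave (x θ t : ℝ) : (macdonaldWave x θ t).re =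
    Real.exp (-(x * Real.cos θ) * Real.cosh t) * Real.cos (x * Real.sin θ * Real.sinh t) := by
  rw [macdonaldWave_eq, Complex.re_ofReal_mul, Complex.exp_ofReal_mul_I_re, Real.cos_neg]

/-- Reflecting `t` conjugates the wave, so the phases cancel. This produces `K_0(2 x cos θ)` in
Parseval's identity. -/
theorem macdonaldWave_mul_neg (x θ t : ℝ) : macdonaldWave x θ t * macdonaldWave x θ (-t) =
    (Real.exp (-(2 * x * Real.cos θ) * Real.cosh t) : ℂ) := by
  simp only [macdonaldWave_eq, Complex.ofReal_exp, Real.cosh_neg, Real.sinh_neg,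
    ← Complex.exp_add]
  push_cast
  ring_nf

theorem continuous_macdonaldWave (x θ : ℝ) : Continuous (macdonaldWave x θ) := by
  unfold macdonaldWave
  have := Complex.continuous_cosh
  fun_prop

theorem integrable_macdonaldWave {x θ : ℝ} (hx : 0 < x) (hθ : 0 < Real.cos θ) :
    Integrable (macdonaldWave x θ) := by
  refine (integrable_exp_neg_mul_cosh (mul_pos hx hθ)).mono'
    (continuous_macdonaldWave x θ).aestronglyMeasurable (.of_forall fun t => ?_)
  rw [norm_macdonaldWave]

theorem norm_exp_I_mul (τ t : ℝ) : ‖Complex.exp (Complex.I * τ * t)‖ = 1 := by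
  rw [show Complex.I * τ * t = (τ * t : ℝ) * Complex.I by push_cast; ring,
    Complex.norm_exp_ofReal_mul_I]

theorem integrable_macdonaldWave_mul_exp {x θ : ℝ} (hx : 0 < x) (hθ : 0 < Real.cos θ) (τ : ℝ) :
    Integrable (fun t : ℝ => macdonaldWave x θ t * Complex.exp (Complex.I * τ * t)) := by
  refine (integrable_exp_neg_mul_cosh (mul_pos hx hθ)).mono' ?_ (.of_forall fun t => ?_)
  · have := continuous_macdonaldWave x θ
    fun_prop
  · rw [norm_mul, norm_macdonaldWave, norm_exp_I_mul, mul_one]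

theorem hasDerivAt_macdonaldWave_left (x θ t : ℝ) :
    HasDerivAt (fun θ => macdonaldWave x θ t)
      (macdonaldWave x θ t * (-x * Complex.sinh (t + θ * Complex.I)) * Complex.I) θ := by
  have h1 : HasDerivAt (fun θ : ℝ => (t + θ * Complex.I : ℂ)) Complex.I θ := by
    simpa using ((Complex.ofRealCLM.hasDerivAt (x := θ)).mul_const Complex.I).const_add (t : ℂ)
  convert! (((Complex.hasDerivAt_cosh _).comp θ h1).const_mul (-x : ℂ)).cexp using 1
  rw [macdonaldWave]
  simp only [Function.comp_apply]
  ring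

theorem hasDerivAt_macdonaldWave_right (x θ t : ℝ) :
    HasDerivAt (fun t => macdonaldWave x θ t)
      (macdonaldWave x θ t * (-x * Complex.sinh (t + θ * Complex.I))) t := by
  have h1 : HasDerivAt (fun t : ℝ => (t + θ * Complex.I : ℂ)) 1 t := by
    simpa using (Complex.ofRealCLM.hasDerivAt (x := t)).add_const (θ * Complex.I : ℂ)
  convert! (((Complex.hasDerivAt_cosh _).comp t h1).const_mul (-x : ℂ)).cexp using 1
  rw [macdonaldWave]
  simp only [Function.comp_apply]
  ring

theorem norm_sinh_add_mul_I_le (t θ : ℝ) :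
    ‖Complex.sinh (t + θ * Complex.I)‖ ≤ Real.cosh t := by
  rw [Complex.sinh]
  have h1 : ‖Complex.exp (t + θ * Complex.I)‖ = Real.exp t := by
    rw [Complex.norm_exp]; simp
  have h2 : ‖Complex.exp (-(t + θ * Complex.I))‖ = Real.exp (-t) := by
    rw [Complex.norm_exp]; simp
  rw [norm_div, Real.cosh_eq, ← h1, ← h2, Complex.norm_ofNat]
  gcongr
  exact norm_sub_le _ _

theorem norm_macdonaldWave_mul_sinh_le {x θ c : ℝ} (hx : 0 < x) (hc : 0 < c)
    (hθ : c ≤ Real.cos θ) (t : ℝ) :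
    ‖macdonaldWave x θ t * (-x * Complex.sinh (t + θ * Complex.I))‖ ≤
      x * (2 / (x * c) * Real.exp (-(x * c / 2) * Real.cosh t)) := by
  have h0 := Real.cosh_pos t
  rw [norm_mul, norm_mul, norm_macdonaldWave, norm_neg, Complex.norm_real,
    Real.norm_of_nonneg hx.le]
  calc _ ≤ Real.exp (-(x * c) * Real.cosh t) * (x * Real.cosh t) := by
        gcongr
        exact norm_sinh_add_mul_I_le t θ
    _ = x * (Real.cosh t * Real.exp (-(x * c) * Real.cosh t)) := by ring
    _ ≤ _ := mul_le_mul_of_nonneg_left (mul_exp_neg_mul_le (mul_pos hx hc)) hx.le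

/-- By Cauchy–Riemann the `θ`-derivative of the wave is `i` times its `t`-derivative. Integrating by
parts in `t` gives a factor `-iτ`, and `i · (-iτ) = τ`. -/
theorem hasDerivAt_integral_macdonaldWave {x θ : ℝ} (hx : 0 < x) (hθ : 0 < Real.cos θ) (τ : ℝ) :
    HasDerivAt (fun θ => ∫ t : ℝ, macdonaldWave x θ t * Complex.exp (Complex.I * τ * t))
      (τ * ∫ t : ℝ, macdonaldWave x θ t * Complex.exp (Complex.I * τ * t)) θ := by
  -- Half of `cos θ` is a lower bound for the cosine on a whole neighbourhood of `θ`, which makes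
  -- the domination uniform there.
  set c := Real.cos θ / 2 with hc
  have hc0 : 0 < c := by positivity
  have hs : {φ : ℝ | c < Real.cos φ} ∈ nhds θ :=
    (isOpen_lt continuous_const Real.continuous_cos).mem_nhds (show c < Real.cos θ by linarith)
  have hbi : Integrable fun t : ℝ => x * (2 / (x * c) * Real.exp (-(x * c / 2) * Real.cosh t)) :=
    ((integrable_exp_neg_mul_cosh (by positivity)).const_mul _).const_mul _
  have hcw := continuous_macdonaldWave x
  have hsinh := Complex.continuous_sinh
  obtain ⟨_, hd⟩ := hasDerivAt_integral_of_dominated_loc_of_deriv_le (x₀ := θ)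
    (F := fun θ t => macdonaldWave x θ t * Complex.exp (Complex.I * τ * t))
    (F' := fun θ t => macdonaldWave x θ t * (-x * Complex.sinh (t + θ * Complex.I)) * Complex.I *
      Complex.exp (Complex.I * τ * t)) (μ := volume) hs
    (.of_forall fun φ => by have := hcw φ; fun_prop)
    (integrable_macdonaldWave_mul_exp hx hθ τ)
    (by have := hcw θ; fun_prop)
    (.of_forall fun t φ hφ => by
      rw [norm_mul, norm_exp_I_mul, mul_one, norm_mul, Complex.norm_I, mul_one]
      exact norm_macdonaldWave_mul_sinh_le hx hc0 (le_of_lt hφ) t) hbi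
    (.of_forall fun t φ _ => (hasDerivAt_macdonaldWave_left x φ t).mul_const _)
  refine hd.congr_deriv ?_
  have hv : ∀ t : ℝ, HasDerivAt (fun t : ℝ => Complex.exp (Complex.I * τ * t))
      (Complex.I * τ * Complex.exp (Complex.I * τ * t)) t := fun t => by
    have h1 : HasDerivAt (fun t : ℝ => (Complex.I * τ * t : ℂ)) (Complex.I * τ) t := by
      simpa using (Complex.ofRealCLM.hasDerivAt (x := t)).const_mul (Complex.I * τ : ℂ)
    simpa [mul_comm] using h1.cexp
  have hi := integrable_macdonaldWave_mul_exp hx hθ τ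
  have hp := integral_mul_deriv_eq_deriv_mul_of_integrable
    (fun t _ => hasDerivAt_macdonaldWave_right x θ t) (fun t _ => hv t)
    ((hi.const_mul (Complex.I * τ)).congr (.of_forall fun t => by
      show _ = macdonaldWave x θ t * (Complex.I * τ * Complex.exp (Complex.I * τ * t))
      ring))
    (hbi.mono' (by have := hcw θ; fun_prop) (.of_forall fun t => by
      simp only [Pi.mul_apply]
      rw [norm_mul, norm_exp_I_mul, mul_one]
      exact norm_macdonaldWave_mul_sinh_le hx hc0 (by linarith) t)) hi
  have h1 : ∀ t : ℝ, macdonaldWave x θ t * (Complex.I * τ * Complex.exp (Complex.I * τ * t)) =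
      Complex.I * τ * (macdonaldWave x θ t * Complex.exp (Complex.I * τ * t)) := fun t => by ring
  have h2 : ∀ t : ℝ, macdonaldWave x θ t * (-x * Complex.sinh (t + θ * Complex.I)) * Complex.I *
      Complex.exp (Complex.I * τ * t) = Complex.I * (macdonaldWave x θ t *
        (-x * Complex.sinh (t + θ * Complex.I)) * Complex.exp (Complex.I * τ * t)) :=
    fun t => by ring
  beta_reduce at hp
  simp_rw [h1] at hp
  simp_rw [h2]
  rw [integral_const_mul] at hp ⊢
  rw [← neg_eq_iff_eq_neg] at hp
  rw [← hp, mul_neg, ← mul_assoc, ← mul_assoc, Complex.I_mul_I]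
  ring

theorem integral_macdonaldWave_zero {x : ℝ} (hx : 0 < x) (τ : ℝ) :
    ∫ t : ℝ, macdonaldWave x 0 t * Complex.exp (Complex.I * τ * t) = 2 * macdonaldKIm τ x := by
  have hi := integrable_macdonaldWave_mul_exp (θ := 0) hx (by simp) τ
  have h1 := integral_neg_eq_self
    (fun t : ℝ => macdonaldWave x 0 t * Complex.exp (Complex.I * τ * t)) volume
  have h2 := integral_add hi hi.comp_neg
  rw [h1] at h2
  have h3 : ∀ t : ℝ, macdonaldWave x 0 t * Complex.exp (Complex.I * τ * t) +
      macdonaldWave x 0 (-t) * Complex.exp (Complex.I * τ * (-t : ℝ)) =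
      2 * ((Real.exp (-x * Real.cosh t) * Real.cos (τ * t) : ℝ) : ℂ) := fun t => by
    simp only [macdonaldWave_eq]
    simp
    rw [Complex.cos]
    ring_nf
  simp_rw [h3] at h2
  rw [integral_const_mul, integral_complex_ofReal, integral_macdonaldKIm_full] at h2
  push_cast at h2
  linear_combination -h2 / 2

theorem cos_pos_of_abs_lt {θ : ℝ} (hθ : |θ| < Real.pi / 2) : 0 < Real.cos θ :=
  Real.cos_pos_of_mem_Ioo (abs_lt.1 hθ)

/-- Shifting the line of integration in the definition of the Macdonald function. -/
theorem integral_macdonaldWave {x θ : ℝ} (hx : 0 < x) (hθ : |θ| < Real.pi / 2) (τ : ℝ) :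
    ∫ t : ℝ, macdonaldWave x θ t * Complex.exp (Complex.I * τ * t) =
      2 * ((Real.exp (τ * θ) * macdonaldKIm τ x : ℝ) : ℂ) := by
  -- The integral satisfies `F' = τ F`, so `e^{-τφ} F(φ)` is constant and can be evaluated at `φ =
  -- 0`; no contour is needed.
  have hd : ∀ φ ∈ Set.Ioo (-(Real.pi / 2)) (Real.pi / 2), HasDerivAt
      (fun φ : ℝ => Complex.exp (-(τ * φ : ℝ)) *
        ∫ t : ℝ, macdonaldWave x φ t * Complex.exp (Complex.I * τ * t)) 0 φ := by
    intro φ hφ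
    have h1 : HasDerivAt (fun φ : ℝ => (-(τ * φ : ℝ) : ℂ)) (-τ) φ := by
      convert! ((Complex.ofRealCLM.hasDerivAt (x := φ)).const_mul (τ : ℂ)).neg using 1
      · ext ψ
        simp
      · simp
    convert! h1.cexp.mul (hasDerivAt_integral_macdonaldWave hx
      (Real.cos_pos_of_mem_Ioo hφ) τ) using 1
    ring
  have h := isOpen_Ioo.is_const_of_deriv_eq_zero isPreconnected_Ioo
    (fun φ hφ => (hd φ hφ).differentiableAt.differentiableWithinAt) (fun φ hφ => (hd φ hφ).deriv)
    (abs_lt.1 hθ) (show (0 : ℝ) ∈ _ from ⟨by linarith [Real.pi_pos], by linarith [Real.pi_pos]⟩)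
  simp only [mul_zero, Complex.ofReal_zero, neg_zero, Complex.exp_zero, one_mul] at h
  rw [integral_macdonaldWave_zero hx, Complex.exp_neg, inv_mul_eq_iff_eq_mul₀
    (Complex.exp_ne_zero _)] at h
  rw [h]
  push_cast
  ring

theorem exp_mul_abs_macdonaldKIm_le {x θ : ℝ} (hx : 0 < x) (hθ : |θ| < Real.pi / 2) (τ : ℝ) :
    Real.exp (τ * θ) * |macdonaldKIm τ x| ≤ macdonaldKZero (x * Real.cos θ) := by
  have h := norm_integral_le_integral_norm (μ := volume)
    (fun t : ℝ => macdonaldWave x θ t * Complex.exp (Complex.I * τ * t))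
  simp_rw [norm_mul, norm_exp_I_mul, mul_one, norm_macdonaldWave] at h
  rw [integral_exp_neg_mul_cosh, integral_macdonaldWave hx hθ, norm_mul, Complex.norm_ofNat,
    Complex.norm_real, norm_mul, Real.norm_of_nonneg (Real.exp_pos _).le, Real.norm_eq_abs] at h
  linarith

theorem integrable_exp_neg_mul_abs {b : ℝ} (hb : 0 < b) :
    Integrable (fun τ : ℝ => Real.exp (-b * |τ|)) := by
  refine (integrable_inv_one_add_sq.const_mul (1 + 2 / b ^ 2)).mono' (by fun_prop)
    (.of_forall fun τ => ?_)
  have h1 := Real.quadratic_le_exp_of_nonneg (show 0 ≤ b * |τ| by positivity)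
  rw [mul_pow, sq_abs] at h1
  rw [Real.norm_of_nonneg (Real.exp_pos _).le, neg_mul, Real.exp_neg, ← div_eq_mul_inv,
    le_div_iff₀ (by positivity), inv_mul_le_iff₀ (Real.exp_pos _)]
  have h2 : 0 ≤ b * |τ| := by positivity
  have h3 : τ ^ 2 ≤ 2 / b ^ 2 * Real.exp (b * |τ|) := by
    rw [div_mul_eq_mul_div, le_div_iff₀ (by positivity)]; nlinarith
  nlinarith [sq_nonneg (b * τ)]

/-- The pointwise bound at an angle `φ` strictly between `|θ|` and `π / 2`, with evenness in `τ`,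
leaves the decay `e^{-(φ - |θ|) |τ|}`. -/
theorem integrable_exp_mul_macdonaldKIm {x θ : ℝ} (hx : 0 < x) (hθ : |θ| < Real.pi / 2) :
    Integrable (fun τ : ℝ => Real.exp (τ * θ) * macdonaldKIm τ x) := by
  obtain ⟨φ, h1, h2⟩ := exists_between hθ
  have h0 : 0 < φ := (abs_nonneg θ).trans_lt h1
  have hK := continuous_macdonaldKIm hx
  refine ((integrable_exp_neg_mul_abs (sub_pos.2 h1)).const_mul
    (macdonaldKZero (x * Real.cos φ))).mono' (by fun_prop) (.of_forall fun τ => ?_)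
  rw [norm_mul, Real.norm_of_nonneg (Real.exp_pos _).le, Real.norm_eq_abs]
  have h3 : Real.exp (|τ| * φ) * |macdonaldKIm τ x| ≤ macdonaldKZero (x * Real.cos φ) := by
    rcases abs_choice τ with h | h <;> rw [h]
    · exact exp_mul_abs_macdonaldKIm_le hx (by rwa [abs_of_pos h0]) τ
    · rw [← macdonaldKIm_neg τ]
      exact exp_mul_abs_macdonaldKIm_le hx (by rwa [abs_of_pos h0]) (-τ)
  calc _ ≤ Real.exp (|τ| * |θ|) * |macdonaldKIm τ x| := by
        refine mul_le_mul_of_nonneg_right (Real.exp_le_exp.2 ?_) (abs_nonneg _)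
        rw [← abs_mul]
        exact le_abs_self _
    _ = (Real.exp (|τ| * φ) * |macdonaldKIm τ x|) * Real.exp (-(φ - |θ|) * |τ|) := by
        rw [mul_right_comm, ← Real.exp_add]; ring_nf
    _ ≤ _ := by gcongr

/-- Fourier inversion for `macdonaldWave`. -/
theorem integral_exp_mul_macdonaldKIm {x θ : ℝ} (hx : 0 < x) (hθ : |θ| < Real.pi / 2) (t : ℝ) :
    ∫ τ : ℝ, ((Real.exp (-(τ * θ)) * macdonaldKIm τ x : ℝ) : ℂ) * Complex.exp (Complex.I * τ * t) =
      Real.pi * macdonaldWave x θ t := by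
  set G : ℝ → ℂ := fun τ => 2 * ((Real.exp (-(τ * θ)) * macdonaldKIm τ x : ℝ) : ℂ) with hG
  have hcos := cos_pos_of_abs_lt hθ
  have hGi : Integrable G := by
    have := (integrable_exp_mul_macdonaldKIm (θ := -θ) hx (by rwa [abs_neg])).ofReal (𝕜 := ℂ)
    simp only [mul_neg] at this
    exact this.const_mul 2
  -- The transform at `ξ` is the shifted integral at `τ = -2πξ`. This flips the sign of `θ` in the
  -- exponential but leaves `K`, even in `τ`, unchanged.
  have hF : FourierTransform.fourier (macdonaldWave x θ) = fun ξ => G (2 * Real.pi * ξ) := by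
    ext ξ
    rw [Real.fourier_real_eq_integral_exp_smul]
    have := integral_macdonaldWave hx hθ (-(2 * Real.pi * ξ))
    rw [macdonaldKIm_neg] at this
    simp only [hG]
    rw [← neg_mul, ← this]
    congr 1 with s
    rw [smul_eq_mul, mul_comm]
    push_cast
    ring_nf
  have hFi : Integrable (FourierTransform.fourier (macdonaldWave x θ)) := by
    rw [hF]; exact hGi.comp_mul_left' (by positivity)
  have hinv := congrFun (Continuous.fourierInv_fourier_eq (continuous_macdonaldWave x θ)
    (integrable_macdonaldWave hx hcos) hFi) t
  rw [Real.fourierInv_eq', hF] at hinv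
  have h2 := Measure.integral_comp_mul_left
    (fun τ : ℝ => Complex.exp (Complex.I * τ * t) * G τ) (2 * Real.pi)
  have h3 : ∀ ξ : ℝ, Complex.exp (Complex.I * (2 * Real.pi * ξ : ℝ) * t) * G (2 * Real.pi * ξ) =
      Complex.exp ((2 * Real.pi * inner ℝ ξ t : ℝ) * Complex.I) • G (2 * Real.pi * ξ) := by
    intro ξ
    rw [smul_eq_mul]
    congr 2
    simp
    ring
  simp_rw [h3] at h2
  rw [hinv, abs_of_pos (by positivity), Complex.real_smul] at h2
  rw [h2]
  have h4 : ∀ τ : ℝ, Complex.exp (Complex.I * τ * t) * G τ =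
      2 * (((Real.exp (-(τ * θ)) * macdonaldKIm τ x : ℝ) : ℂ) *
        Complex.exp (Complex.I * τ * t)) := fun τ => by simp only [hG]; ring
  simp_rw [h4]
  rw [integral_const_mul]
  have hX : ∀ X : ℂ, X = Real.pi * (((2 * Real.pi)⁻¹ : ℝ) * (2 * X)) := fun X => by
    push_cast
    field_simp
  exact hX _

/-- Parseval's identity for `macdonaldWave`. -/
theorem integral_sq_exp_mul_macdonaldKIm {x θ : ℝ} (hx : 0 < x) (hθ : |θ| < Real.pi / 2) :
    ∫ τ : ℝ, (Real.exp (τ * θ) * macdonaldKIm τ x) ^ 2 =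
      Real.pi * macdonaldKZero (2 * x * Real.cos θ) := by
  have hcos := cos_pos_of_abs_lt hθ
  have hg := integrable_exp_mul_macdonaldKIm hx hθ
  have hE := integrable_macdonaldWave hx hcos
  have hi : Integrable (Function.uncurry fun τ t : ℝ =>
      ((Real.exp (τ * θ) * macdonaldKIm τ x : ℝ) : ℂ) *
        (macdonaldWave x θ t * Complex.exp (Complex.I * τ * t))) (volume.prod volume) := by
    have hp := (hg.ofReal (𝕜 := ℂ)).mul_prod hE
    refine hp.norm.mono' ?_ (.of_forall fun p => ?_)
    · have hc1 := continuous_macdonaldWave x θ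
      have hc2 := continuous_macdonaldKIm hx
      exact Continuous.aestronglyMeasurable (by fun_prop)
    · simp only [Function.uncurry_def]
      rw [← mul_assoc, norm_mul, norm_exp_I_mul, mul_one]
      rfl
  -- One of the two factors is written as the wave integral; after Fubini, inversion applied to the
  -- other gives the wave at `-t`.
  have h1 : ∀ τ : ℝ, (((Real.exp (τ * θ) * macdonaldKIm τ x) ^ 2 : ℝ) : ℂ) =
      1 / 2 * ∫ t : ℝ, ((Real.exp (τ * θ) * macdonaldKIm τ x : ℝ) : ℂ) *
        (macdonaldWave x θ t * Complex.exp (Complex.I * τ * t)) := fun τ => by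
    rw [integral_const_mul, integral_macdonaldWave hx hθ]
    push_cast
    ring
  have h2 : ∀ t : ℝ, ∫ τ : ℝ, ((Real.exp (τ * θ) * macdonaldKIm τ x : ℝ) : ℂ) *
      (macdonaldWave x θ t * Complex.exp (Complex.I * τ * t)) =
      Real.pi * (Real.exp (-(2 * x * Real.cos θ) * Real.cosh t) : ℝ) := fun t => by
    rw [← macdonaldWave_mul_neg, mul_left_comm, ← integral_exp_mul_macdonaldKIm hx hθ,
      ← integral_const_mul, ← integral_neg_eq_self]
    congr 1 with τ
    rw [macdonaldKIm_neg]
    push_cast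
    ring_nf
  have h3 : ((∫ τ : ℝ, (Real.exp (τ * θ) * macdonaldKIm τ x) ^ 2 : ℝ) : ℂ) =
      ((Real.pi * macdonaldKZero (2 * x * Real.cos θ) : ℝ) : ℂ) := by
    rw [← integral_complex_ofReal]
    simp_rw [h1]
    rw [integral_const_mul, integral_integral_swap hi]
    simp_rw [h2]
    rw [integral_const_mul, integral_complex_ofReal, integral_exp_neg_mul_cosh]
    push_cast
    ring
  exact_mod_cast h3

theorem integrable_sq_exp_mul_macdonaldKIm {x θ : ℝ} (hx : 0 < x) (hθ : |θ| < Real.pi / 2) :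
    Integrable fun τ : ℝ => (Real.exp (τ * θ) * macdonaldKIm τ x) ^ 2 := by
  have hK := continuous_macdonaldKIm hx
  refine ((integrable_exp_mul_macdonaldKIm hx hθ).norm.const_mul
    (macdonaldKZero (x * Real.cos θ))).mono' (by fun_prop) (.of_forall fun τ => ?_)
  rw [norm_pow, sq]
  gcongr
  rw [norm_mul, Real.norm_of_nonneg (Real.exp_pos _).le, Real.norm_eq_abs]
  exact exp_mul_abs_macdonaldKIm_le hx hθ τ

/-- The regularised cosine inversion formula. -/
theorem integral_cosh_mul_macdonaldKIm_mul_cos {x θ : ℝ} (hx : 0 < x) (hθ : |θ| < Real.pi / 2)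
    (t : ℝ) :
    ∫ τ in Set.Ioi (0 : ℝ), Real.cosh (θ * τ) * macdonaldKIm τ x * Real.cos (τ * t) =
      Real.pi / 2 * (Real.exp (-(x * Real.cos θ) * Real.cosh t) *
        Real.cos (x * Real.sin θ * Real.sinh t)) := by
  have key : ∀ φ : ℝ, |φ| < Real.pi / 2 →
      Integrable (fun τ : ℝ => Real.exp (-(τ * φ)) * macdonaldKIm τ x * Real.cos (τ * t)) ∧
      ∫ τ : ℝ, Real.exp (-(τ * φ)) * macdonaldKIm τ x * Real.cos (τ * t) =
        Real.pi * (Real.exp (-(x * Real.cos φ) * Real.cosh t) *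
          Real.cos (x * Real.sin φ * Real.sinh t)) := by
    intro φ hφ
    have hg : Integrable fun τ : ℝ => Real.exp (-(τ * φ)) * macdonaldKIm τ x := by
      simpa only [mul_neg] using integrable_exp_mul_macdonaldKIm (θ := -φ) hx (by rwa [abs_neg])
    have hK := continuous_macdonaldKIm hx
    have hi : Integrable fun τ : ℝ => ((Real.exp (-(τ * φ)) * macdonaldKIm τ x : ℝ) : ℂ) *
        Complex.exp (Complex.I * τ * t) := by
      refine hg.norm.mono' (by fun_prop) (.of_forall fun τ => ?_)
      rw [norm_mul, norm_exp_I_mul, mul_one, Complex.norm_real]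
    have hre : ∀ τ : ℝ, (((Real.exp (-(τ * φ)) * macdonaldKIm τ x : ℝ) : ℂ) *
        Complex.exp (Complex.I * τ * t)).re =
        Real.exp (-(τ * φ)) * macdonaldKIm τ x * Real.cos (τ * t) := fun τ => by
      rw [Complex.re_ofReal_mul, show Complex.I * τ * t = (τ * t : ℝ) * Complex.I by
        push_cast; ring, Complex.exp_ofReal_mul_I_re]
    refine ⟨hi.re.congr (.of_forall hre), ?_⟩
    have h := congrArg Complex.re (integral_exp_mul_macdonaldKIm hx hφ t)
    rw [Complex.re_ofReal_mul, re_macdonaldWave, ← RCLike.re_eq_complex_re, ← integral_re hi] at h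
    rw [← h]
    exact integral_congr_ae (.of_forall fun τ => (hre τ).symm)
  -- Angles `θ` and `-θ` give the same real part, and adding them turns the exponentials into `2
  -- cosh (θ τ)`.
  obtain ⟨i1, h1⟩ := key θ hθ
  obtain ⟨i2, h2⟩ := key (-θ) (by rwa [abs_neg])
  have h3 := integral_add i1 i2
  rw [h1, h2, Real.cos_neg, Real.sin_neg, mul_neg,
    neg_mul (x * Real.sin θ), Real.cos_neg] at h3
  have h4 := integral_comp_abs
    (f := fun τ => Real.cosh (θ * τ) * macdonaldKIm τ x * Real.cos (τ * t))
  have h5 : ∀ τ : ℝ, Real.exp (-(τ * θ)) * macdonaldKIm τ x * Real.cos (τ * t) +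
      Real.exp (-(τ * -θ)) * macdonaldKIm τ x * Real.cos (τ * t) =
      2 * (Real.cosh (θ * |τ|) * macdonaldKIm |τ| x * Real.cos (|τ| * t)) := by
    intro τ
    rcases abs_choice τ with h | h <;> rw [h]
    · rw [Real.cosh_eq]; ring_nf
    · rw [Real.cosh_eq, macdonaldKIm_neg, neg_mul τ t, Real.cos_neg]; ring_nf
  simp_rw [h5] at h3
  rw [integral_const_mul, h4] at h3
  linarith

/-! ### Integrability at the critical angle `π / 2`. -/

theorem macdonaldKZero_mul_sin_le {x : ℝ} (hx : 0 < x) : ∃ C : ℝ, 0 < C ∧ ∀ δ ∈ Set.Ioo (0 : ℝ) 1,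
    macdonaldKZero (2 * x * Real.sin δ) ≤ C * δ ^ (-(1 / 4) : ℝ) := by
  obtain ⟨C, hC, h⟩ := macdonaldKZero_le
  have hp := Real.pi_pos
  refine ⟨C * (2 * x * (2 / Real.pi)) ^ (-(1 / 4) : ℝ), by positivity, fun δ hδ => ?_⟩
  have h1 : 2 / Real.pi * δ ≤ Real.sin δ :=
    Real.mul_le_sin hδ.1.le (by linarith [Real.pi_gt_three, hδ.2])
  have h0 := hδ.1
  have h2 : 0 < 2 / Real.pi * δ := by positivity
  have h3 : 0 < Real.sin δ := h2.trans_le h1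
  calc macdonaldKZero (2 * x * Real.sin δ) ≤ C * (2 * x * Real.sin δ) ^ (-(1 / 4) : ℝ) :=
        h _ (by positivity)
    _ ≤ C * (2 * x * (2 / Real.pi * δ)) ^ (-(1 / 4) : ℝ) := by
        gcongr C * ?_
        exact Real.rpow_le_rpow_of_nonpos (by positivity) (by gcongr) (by norm_num)
    _ = _ := by rw [← mul_assoc (2 * x), Real.mul_rpow (by positivity) h0.le, ← mul_assoc C]

theorem abs_pi_div_two_sub_lt {δ : ℝ} (hδ : δ ∈ Set.Ioo (0 : ℝ) 1) :
    |Real.pi / 2 - δ| < Real.pi / 2 := by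
  rw [abs_of_pos] <;> linarith [Real.pi_gt_three, hδ.1, hδ.2]

/-- At angle `π / 2 - δ`, Parseval bounds the `τ` integral by `π K_0(2 x sin δ) = O(δ^{-1/4})`; with
the weight this is `O(δ^{-3/4})`, integrable on `(0, 1)`. -/
theorem integrable_regularised_sq_macdonaldKIm {x : ℝ} (hx : 0 < x) :
    Integrable (fun p : ℝ × ℝ => p.2 ^ (-(1 / 2) : ℝ) *
      (Real.exp (p.1 * (Real.pi / 2 - p.2)) * macdonaldKIm p.1 x) ^ 2)
      ((volume.restrict (Set.Ioi 1)).prod (volume.restrict (Set.Ioo 0 1))) := by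
  obtain ⟨C, hC, hb⟩ := macdonaldKZero_mul_sin_le hx
  have hK := continuous_macdonaldKIm hx
  have hmeas : Measurable (fun p : ℝ × ℝ => p.2 ^ (-(1 / 2) : ℝ) *
      (Real.exp (p.1 * (Real.pi / 2 - p.2)) * macdonaldKIm p.1 x) ^ 2) :=
    (measurable_snd.pow_const _).mul
      (by fun_prop : Continuous fun p : ℝ × ℝ =>
        (Real.exp (p.1 * (Real.pi / 2 - p.2)) * macdonaldKIm p.1 x) ^ 2).measurable
  refine (integrable_prod_iff' hmeas.aestronglyMeasurable).2 ⟨?_, ?_⟩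
  · refine ae_restrict_of_forall_mem measurableSet_Ioo fun δ hδ => ?_
    exact ((integrable_sq_exp_mul_macdonaldKIm hx (abs_pi_div_two_sub_lt hδ)).const_mul
      (δ ^ (-(1 / 2) : ℝ))).integrableOn
  · have hi : IntegrableOn (fun δ : ℝ => Real.pi * C * δ ^ (-(3 / 4) : ℝ)) (Set.Ioo 0 1) :=
      ((intervalIntegral.integrableOn_Ioo_rpow_iff zero_lt_one).2 (by norm_num)).const_mul _
    refine Integrable.mono' hi (AEStronglyMeasurable.integral_prod_right'
      (f := fun p : ℝ × ℝ => ‖p.1 ^ (-(1 / 2) : ℝ) *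
        (Real.exp (p.2 * (Real.pi / 2 - p.1)) * macdonaldKIm p.2 x) ^ 2‖)
      (hmeas.comp measurable_swap).norm.aestronglyMeasurable) ?_
    refine ae_restrict_of_forall_mem measurableSet_Ioo fun δ hδ => ?_
    have h0 := hδ.1
    rw [Real.norm_of_nonneg (integral_nonneg fun _ => norm_nonneg _)]
    have hint := integrable_sq_exp_mul_macdonaldKIm hx (abs_pi_div_two_sub_lt hδ)
    calc _ = δ ^ (-(1 / 2) : ℝ) * ∫ τ in Set.Ioi (1 : ℝ),
          (Real.exp (τ * (Real.pi / 2 - δ)) * macdonaldKIm τ x) ^ 2 := by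
          rw [← integral_const_mul]
          congr 1 with τ
          exact Real.norm_of_nonneg (by positivity)
      _ ≤ δ ^ (-(1 / 2) : ℝ) * (Real.pi * (C * δ ^ (-(1 / 4) : ℝ))) := by
          gcongr
          refine (setIntegral_le_integral hint (.of_forall fun _ => sq_nonneg _)).trans ?_
          rw [integral_sq_exp_mul_macdonaldKIm hx (abs_pi_div_two_sub_lt hδ),
            Real.cos_pi_div_two_sub]
          gcongr
          exact hb δ hδ
      _ = Real.pi * C * (δ ^ (-(1 / 2) : ℝ) * δ ^ (-(1 / 4) : ℝ)) := by ring
      _ = _ := by rw [← Real.rpow_add h0]; norm_num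

/-- It suffices to keep `δ < 1 / τ`, where `e^{-2δτ} ≥ e^{-2}` and `δ^{-1/2} ≥ τ^{1/2}`. -/
theorem rpow_le_integral_rpow_mul_exp {τ : ℝ} (hτ : 1 < τ) :
    Real.exp (-2) * τ ^ (-(1 / 2) : ℝ) ≤
      ∫ δ in Set.Ioo (0 : ℝ) 1, δ ^ (-(1 / 2) : ℝ) * Real.exp (-(2 * δ * τ)) := by
  have h0 : 0 < τ := by linarith
  have hi : IntegrableOn (fun δ : ℝ => δ ^ (-(1 / 2) : ℝ) * Real.exp (-(2 * δ * τ)))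
      (Set.Ioo 0 1) := by
    refine Integrable.mono' ((intervalIntegral.integrableOn_Ioo_rpow_iff zero_lt_one).2
      (show (-1 : ℝ) < -(1 / 2) by norm_num))
      (by fun_prop) (ae_restrict_of_forall_mem measurableSet_Ioo fun δ hδ => ?_)
    have := hδ.1
    rw [Real.norm_of_nonneg (by positivity)]
    exact mul_le_of_le_one_right (by positivity) (by rw [Real.exp_le_one_iff]; simp; positivity)
  have hsub : Set.Ioo 0 τ⁻¹ ⊆ Set.Ioo (0 : ℝ) 1 :=
    Set.Ioo_subset_Ioo_right (inv_le_one_of_one_le₀ hτ.le)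
  calc Real.exp (-2) * τ ^ (-(1 / 2) : ℝ)
      = ∫ δ in Set.Ioo (0 : ℝ) τ⁻¹, Real.exp (-2) * τ ^ (1 / 2 : ℝ) := by
        rw [setIntegral_const]
        simp only [Real.volume_real_Ioo_of_le (inv_nonneg.2 h0.le), sub_zero, smul_eq_mul]
        rw [mul_left_comm, ← Real.rpow_neg_one, ← Real.rpow_add h0]
        norm_num
    _ ≤ ∫ δ in Set.Ioo (0 : ℝ) τ⁻¹, δ ^ (-(1 / 2) : ℝ) * Real.exp (-(2 * δ * τ)) := by
        refine setIntegral_mono_on (integrableOn_const (by simp)) (hi.mono_set hsub)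
          measurableSet_Ioo fun δ hδ => ?_
        have h1 := hδ.1
        have h2 : δ * τ ≤ 1 := by
          have := hδ.2.le
          rwa [← one_div, le_div_iff₀ h0] at this
        rw [mul_comm]
        gcongr
        · have := Real.rpow_le_rpow_of_nonpos h1 hδ.2.le (show (-(1 / 2) : ℝ) ≤ 0 by norm_num)
          rwa [Real.inv_rpow h0.le, Real.rpow_neg h0.le, inv_inv] at this
        · linarith
    _ ≤ _ := setIntegral_mono_set hi (ae_restrict_of_forall_mem measurableSet_Ioo fun δ hδ => by
        have := hδ.1
        positivity) hsub.eventuallyLE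

/-- Integrating the regularised square over `δ` first reproduces the weight `τ^{-1/2}` up to the
constant `e²`. -/
theorem integrableOn_weighted_sq_macdonaldKIm {x : ℝ} (hx : 0 < x) :
    IntegrableOn (fun τ : ℝ => τ ^ (-(1 / 2) : ℝ) *
      (Real.exp (τ * (Real.pi / 2)) * macdonaldKIm τ x) ^ 2) (Set.Ioi 1) := by
  have hK := continuous_macdonaldKIm hx
  have hI := (integrable_regularised_sq_macdonaldKIm hx).integral_prod_left
  refine Integrable.mono' (hI.const_mul (Real.exp 2)) ?_
    (ae_restrict_of_forall_mem measurableSet_Ioi fun τ hτ => ?_)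
  · exact ((measurable_id.pow_const _).mul (by fun_prop : Continuous fun τ : ℝ =>
      (Real.exp (τ * (Real.pi / 2)) * macdonaldKIm τ x) ^ 2).measurable).aestronglyMeasurable
  · have h0 : 0 < τ := lt_trans zero_lt_one hτ
    have h1 : ∀ δ : ℝ, δ ^ (-(1 / 2) : ℝ) *
        (Real.exp (τ * (Real.pi / 2 - δ)) * macdonaldKIm τ x) ^ 2 =
        (Real.exp (τ * (Real.pi / 2)) * macdonaldKIm τ x) ^ 2 *
          (δ ^ (-(1 / 2) : ℝ) * Real.exp (-(2 * δ * τ))) := fun δ => by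
      rw [show -(2 * δ * τ) = (2 : ℕ) * (-(δ * τ)) by push_cast; ring, Real.exp_nat_mul,
        show τ * (Real.pi / 2 - δ) = τ * (Real.pi / 2) + -(δ * τ) by ring, Real.exp_add]
      ring
    rw [Real.norm_of_nonneg (by positivity)]
    simp_rw [h1]
    rw [integral_const_mul]
    have h2 := rpow_le_integral_rpow_mul_exp hτ
    have h3 : Real.exp 2 * Real.exp (-2) = 1 := by rw [← Real.exp_add]; simp
    calc τ ^ (-(1 / 2) : ℝ) * (Real.exp (τ * (Real.pi / 2)) * macdonaldKIm τ x) ^ 2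
        = Real.exp 2 * ((Real.exp (τ * (Real.pi / 2)) * macdonaldKIm τ x) ^ 2 *
          (Real.exp (-2) * τ ^ (-(1 / 2) : ℝ))) := by linear_combination -(τ ^ (-(1 / 2) : ℝ) *
            (Real.exp (τ * (Real.pi / 2)) * macdonaldKIm τ x) ^ 2) * h3
      _ ≤ _ := by gcongr

/-- On `(0, 1]` continuity suffices. Beyond `1`, split `1 / τ = τ^{-1/4} τ^{-3/4}` and use `a b ≤ a²
+ b²`: one square is the weighted one above, the other is `M² τ^{-3/2}`. -/
theorem integrableOn_exp_mul_macdonaldKIm_mul {x : ℝ} (hx : 0 < x) {r : ℝ → ℝ}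
    (hr : Continuous r) {M : ℝ} (hM : ∀ τ, 0 < τ → |r τ| ≤ M / τ) :
    IntegrableOn (fun τ : ℝ => Real.exp (τ * (Real.pi / 2)) * macdonaldKIm τ x * r τ)
      (Set.Ioi 0) := by
  have hK := continuous_macdonaldKIm hx
  have hc : Continuous fun τ : ℝ => Real.exp (τ * (Real.pi / 2)) * macdonaldKIm τ x * r τ := by
    fun_prop
  rw [← Set.Ioc_union_Ioi_eq_Ioi zero_le_one]
  refine IntegrableOn.union (hc.integrableOn_Icc.mono_set Set.Ioc_subset_Icc_self) ?_
  refine Integrable.mono' ((integrableOn_weighted_sq_macdonaldKIm hx).add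
    (((integrableOn_Ioi_rpow_of_lt (show (-(3 / 2) : ℝ) < -1 by norm_num) zero_lt_one)).const_mul
      (M ^ 2))) hc.aestronglyMeasurable
    (ae_restrict_of_forall_mem measurableSet_Ioi fun τ hτ => ?_)
  have h0 : 0 < τ := lt_trans zero_lt_one hτ
  set A := Real.exp (τ * (Real.pi / 2)) * macdonaldKIm τ x
  have e1 : τ ^ (-(1 / 2) : ℝ) = (τ ^ (-(1 / 4) : ℝ)) ^ 2 := by
    rw [← Real.rpow_natCast, ← Real.rpow_mul h0.le]; norm_num
  have e2 : τ ^ (-(3 / 2) : ℝ) = (τ ^ (-(3 / 4) : ℝ)) ^ 2 := by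
    rw [← Real.rpow_natCast, ← Real.rpow_mul h0.le]; norm_num
  have e3 : τ ^ (-(1 / 4) : ℝ) * τ ^ (-(3 / 4) : ℝ) = τ⁻¹ := by
    rw [← Real.rpow_add h0, ← Real.rpow_neg_one]; norm_num
  have hM0 : 0 ≤ M := by
    have := (abs_nonneg _).trans (hM 1 one_pos)
    simpa using this
  have h2 : ‖A * r τ‖ ≤ (τ ^ (-(1 / 4) : ℝ) * |A|) * (M * τ ^ (-(3 / 4) : ℝ)) := by
    calc ‖A * r τ‖ = |A| * |r τ| := by rw [Real.norm_eq_abs, abs_mul]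
      _ ≤ |A| * (M / τ) := by gcongr; exact hM τ h0
      _ = _ := by rw [div_eq_mul_inv, ← e3]; ring
  refine h2.trans ?_
  simp only [Pi.add_apply]
  rw [e1, e2, ← sq_abs A]
  nlinarith [sq_nonneg (τ ^ (-(1 / 4) : ℝ) * |A| - M * τ ^ (-(3 / 4) : ℝ)),
    mul_nonneg (mul_nonneg (Real.rpow_nonneg h0.le (-(1 / 4) : ℝ)) (abs_nonneg A))
      (mul_nonneg hM0 (Real.rpow_nonneg h0.le (-(3 / 4) : ℝ)))]

/-! ### Cosine inversion at the critical angle. -/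

theorem cosh_mul_le_exp {θ τ : ℝ} (hθ : |θ| ≤ Real.pi / 2) (hτ : 0 < τ) :
    Real.cosh (θ * τ) ≤ Real.exp (τ * (Real.pi / 2)) := by
  rw [← Real.cosh_abs, abs_mul, abs_of_pos hτ, Real.cosh_eq]
  have h1 : Real.exp (|θ| * τ) ≤ Real.exp (τ * (Real.pi / 2)) := by
    rw [Real.exp_le_exp]; nlinarith
  have h2 : Real.exp (-(|θ| * τ)) ≤ Real.exp (τ * (Real.pi / 2)) := by
    rw [Real.exp_le_exp]; nlinarith [abs_nonneg θ]
  linarith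

/-- Cosine inversion for `cosh (π τ / 2) K_{iτ}(x)`, tested against a function whose cosine
transform decays. -/
theorem integral_cosh_mul_macdonaldKIm_mul {x w : ℝ} (hx : 0 < x) (hw : 0 ≤ w) {f : ℝ → ℝ}
    (hf : Continuous f) {M : ℝ}
    (hM : ∀ τ, 0 < τ → |∫ u in (0 : ℝ)..w, f u * Real.cos (τ * u)| ≤ M / τ) :
    IntegrableOn (fun τ => Real.cosh (Real.pi / 2 * τ) * macdonaldKIm τ x *
      ∫ u in (0 : ℝ)..w, f u * Real.cos (τ * u)) (Set.Ioi 0) ∧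
    ∫ τ in Set.Ioi (0 : ℝ), Real.cosh (Real.pi / 2 * τ) * macdonaldKIm τ x *
      ∫ u in (0 : ℝ)..w, f u * Real.cos (τ * u) =
    Real.pi / 2 * ∫ u in (0 : ℝ)..w, f u * Real.cos (x * Real.sinh u) := by
  set r : ℝ → ℝ := fun τ => ∫ u in (0 : ℝ)..w, f u * Real.cos (τ * u) with hr
  have hrc : Continuous r :=
    intervalIntegral.continuous_parametric_intervalIntegral_of_continuous' (by fun_prop) _ _
  have hK := continuous_macdonaldKIm hx
  have hpi := Real.pi_pos
  have hbi := (integrableOn_exp_mul_macdonaldKIm_mul hx hrc hM).norm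
  have hbound : ∀ θ : ℝ, |θ| ≤ Real.pi / 2 → ∀ τ ∈ Set.Ioi (0 : ℝ),
      ‖Real.cosh (θ * τ) * macdonaldKIm τ x * r τ‖ ≤
        ‖Real.exp (τ * (Real.pi / 2)) * macdonaldKIm τ x * r τ‖ := by
    intro θ hθ τ hτ
    rw [norm_mul, norm_mul, norm_mul, norm_mul, Real.norm_of_nonneg (Real.exp_pos _).le,
      Real.norm_of_nonneg (Real.cosh_pos _).le]
    gcongr
    exact cosh_mul_le_exp hθ hτ
  refine ⟨Integrable.mono' hbi (Continuous.aestronglyMeasurable (by fun_prop))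
    (ae_restrict_of_forall_mem measurableSet_Ioi (hbound _ (abs_of_pos (by positivity)).le)), ?_⟩
  have hreg : ∀ θ ∈ Set.Ioo 0 (Real.pi / 2),
      ∫ τ in Set.Ioi (0 : ℝ), Real.cosh (θ * τ) * macdonaldKIm τ x * r τ =
      ∫ u in (0 : ℝ)..w, f u * (Real.pi / 2 * (Real.exp (-(x * Real.cos θ) * Real.cosh u) *
        Real.cos (x * Real.sin θ * Real.sinh u))) := by
    intro θ hθ
    have hθ' : |θ| < Real.pi / 2 := by rw [abs_of_pos hθ.1]; exact hθ.2
    have hki : IntegrableOn (fun τ : ℝ => Real.cosh (θ * τ) * macdonaldKIm τ x) (Set.Ioi 0) := by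
      have h1 := integrable_exp_mul_macdonaldKIm hx hθ'
      have h2 := integrable_exp_mul_macdonaldKIm (θ := -θ) hx (by rwa [abs_neg])
      refine (((h1.add h2).div_const 2).congr (.of_forall fun τ => ?_)).integrableOn
      simp only [Pi.add_apply]
      rw [Real.cosh_eq]
      ring_nf
    have := (integral_mul_intervalIntegral_swap hki (φ := fun τ u => Real.cos (τ * u)) (h := f)
      hw (by fun_prop) hf (fun τ u _ => Real.abs_cos_le_one _)).2
    simp_rw [integral_cosh_mul_macdonaldKIm_mul_cos hx hθ'] at this
    exact this
  have hmem : Set.Ioo 0 (Real.pi / 2) ∈ nhdsWithin (Real.pi / 2) (Set.Iio (Real.pi / 2)) :=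
    Ioo_mem_nhdsLT (by positivity)
  -- Both sides of the regularised identity pass to the limit: the `τ` side by domination uniform in
  -- `θ`, the `u` side by joint continuity on a compact interval.
  have hlim1 : Filter.Tendsto
      (fun θ => ∫ τ in Set.Ioi (0 : ℝ), Real.cosh (θ * τ) * macdonaldKIm τ x * r τ)
      (nhdsWithin (Real.pi / 2) (Set.Iio (Real.pi / 2)))
      (nhds (∫ τ in Set.Ioi (0 : ℝ), Real.cosh (Real.pi / 2 * τ) * macdonaldKIm τ x * r τ)) := by
    refine tendsto_integral_filter_of_dominated_convergence _
      (.of_forall fun θ => Continuous.aestronglyMeasurable (by fun_prop)) ?_ hbi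
      (.of_forall fun τ => ?_)
    · filter_upwards [hmem] with θ hθ
      exact ae_restrict_of_forall_mem measurableSet_Ioi
        (hbound θ (by rw [abs_of_pos hθ.1]; exact hθ.2.le))
    · exact ((by fun_prop : Continuous fun θ : ℝ =>
        Real.cosh (θ * τ) * macdonaldKIm τ x * r τ).tendsto _).mono_left nhdsWithin_le_nhds
  have hlim2 : Filter.Tendsto
      (fun θ => ∫ u in (0 : ℝ)..w, f u * (Real.pi / 2 *
        (Real.exp (-(x * Real.cos θ) * Real.cosh u) * Real.cos (x * Real.sin θ * Real.sinh u))))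
      (nhdsWithin (Real.pi / 2) (Set.Iio (Real.pi / 2)))
      (nhds (∫ u in (0 : ℝ)..w, f u * (Real.pi / 2 *
        (Real.exp (-(x * Real.cos (Real.pi / 2)) * Real.cosh u) *
          Real.cos (x * Real.sin (Real.pi / 2) * Real.sinh u))))) :=
    ((intervalIntegral.continuous_parametric_intervalIntegral_of_continuous'
      (by fun_prop) _ _).tendsto (Real.pi / 2)).mono_left nhdsWithin_le_nhds
  have h := tendsto_nhds_unique (hlim1.congr' (by filter_upwards [hmem] with θ hθ; exact hreg θ hθ))
    hlim2
  rw [h, ← intervalIntegral.integral_const_mul]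
  congr 1 with u
  simp
  ring

/-- One integration by parts; `f` need not vanish at `w`, so the boundary term stays in the
constant. -/
theorem abs_integral_mul_cos_le {f f' : ℝ → ℝ} (hf : ∀ u, HasDerivAt f (f' u) u)
    (hf' : Continuous f') {w : ℝ} (hw : 0 ≤ w) :
    ∃ M : ℝ, ∀ τ, 0 < τ → |∫ u in (0 : ℝ)..w, f u * Real.cos (τ * u)| ≤ M / τ := by
  refine ⟨|f w| + ∫ u in (0 : ℝ)..w, |f' u|, fun τ hτ => ?_⟩
  have hv : ∀ u : ℝ, HasDerivAt (fun u => Real.sin (τ * u) / τ) (Real.cos (τ * u)) u := fun u => by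
    have := ((hasDerivAt_id u).const_mul τ).sin.div_const τ
    simpa [hτ.ne'] using this
  rw [intervalIntegral.integral_mul_deriv_eq_deriv_mul (fun u _ => hf u) (fun u _ => hv u)
    (hf'.intervalIntegrable _ _) (Continuous.intervalIntegrable (by fun_prop) _ _), add_div]
  simp only [mul_zero, Real.sin_zero, zero_div, sub_zero]
  refine (abs_sub _ _).trans (add_le_add ?_ ?_)
  · rw [abs_mul, abs_div, abs_of_pos hτ, ← mul_div_assoc]
    gcongr
    exact mul_le_of_le_one_right (abs_nonneg _) (Real.abs_sin_le_one _)
  · refine (intervalIntegral.abs_integral_le_integral_abs hw).trans ?_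
    rw [← intervalIntegral.integral_div]
    refine intervalIntegral.integral_mono_on hw (Continuous.intervalIntegrable (by fun_prop) _ _)
      (Continuous.intervalIntegrable (by fun_prop) _ _) fun u _ => ?_
    rw [abs_mul, abs_div, abs_of_pos hτ, ← mul_div_assoc]
    gcongr
    exact mul_le_of_le_one_right (abs_nonneg _) (Real.abs_sin_le_one _)

/-! ### The biorthogonality relation with respect to `τ sinh (π τ) dτ`. -/

/-- The endpoint `arsinh π` is chosen so that `sin (m sinh u)` becomes `sin (m π) = 0` there, which
removes the boundary term. -/
theorem mul_integral_sin_mul_sinh_mul_sin {m : ℕ} (τ : ℝ) :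
    τ * ∫ u in (0 : ℝ)..Real.arsinh Real.pi, Real.sin (m * Real.sinh u) * Real.sin (τ * u) =
      ∫ u in (0 : ℝ)..Real.arsinh Real.pi,
        (m * Real.cosh u * Real.cos (m * Real.sinh u)) * Real.cos (τ * u) := by
  have hu : ∀ u : ℝ, HasDerivAt (fun u => Real.sin (m * Real.sinh u))
      (m * Real.cosh u * Real.cos (m * Real.sinh u)) u := fun u => by
    simpa [mul_comm] using ((Real.hasDerivAt_sinh u).const_mul (m : ℝ)).sin
  have hv : ∀ u : ℝ, HasDerivAt (fun u => -Real.cos (τ * u)) (τ * Real.sin (τ * u)) u := fun u => by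
    simpa [mul_comm] using ((hasDerivAt_id u).const_mul τ).cos.fun_neg
  have h := intervalIntegral.integral_mul_deriv_eq_deriv_mul (a := 0) (b := Real.arsinh Real.pi)
    (fun u _ => hu u) (fun u _ => hv u)
    (Continuous.intervalIntegrable (by fun_prop) _ _)
    (Continuous.intervalIntegrable (by fun_prop) _ _)
  rw [Real.sinh_arsinh, Real.sin_nat_mul_pi, Real.sinh_zero, mul_zero, Real.sin_zero] at h
  simp only [zero_mul, neg_zero, sub_zero, zero_sub, mul_neg, intervalIntegral.integral_neg,
    neg_neg] at h
  rw [← h, ← intervalIntegral.integral_const_mul]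
  congr 1 with u
  ring

/-- The normalisation `sin (iπτ/2) = i sinh (πτ/2)` cancels against `sinh (πτ) = 2 sinh (πτ/2) cosh
(πτ/2)`, and `τ` is absorbed by parts. -/
theorem besselKs_I_mul_mul {m : ℕ} {τ : ℝ} (hτ : 0 < τ) :
    besselKs m (Complex.I * τ) (Real.arsinh Real.pi) * ((τ * Real.sinh (Real.pi * τ) : ℝ) : ℂ) =
      ((2 * (Real.cosh (Real.pi / 2 * τ) * ∫ u in (0 : ℝ)..Real.arsinh Real.pi,
        (m * Real.cosh u * Real.cos (m * Real.sinh u)) * Real.cos (τ * u)) : ℝ) : ℂ) := by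
  have hs : Real.sinh (Real.pi / 2 * τ) ≠ 0 := by
    rw [Real.sinh_ne_zero]
    have := Real.pi_pos
    positivity
  have hs' : (Real.sinh (Real.pi / 2 * τ) : ℂ) ≠ 0 := by exact_mod_cast hs
  have hint : ∫ u in (0 : ℝ)..Real.arsinh Real.pi,
      (Real.sin (m * Real.sinh u) : ℂ) * Complex.sinh (Complex.I * τ * u) =
      Complex.I * ((∫ u in (0 : ℝ)..Real.arsinh Real.pi,
        Real.sin (m * Real.sinh u) * Real.sin (τ * u) : ℝ) : ℂ) := by
    rw [← intervalIntegral.integral_ofReal, ← intervalIntegral.integral_const_mul]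
    congr 1 with u
    rw [show Complex.I * τ * u = (τ * u : ℂ) * Complex.I by ring, Complex.sinh_mul_I]
    push_cast
    ring
  rw [besselKs, hint, show Real.pi * (Complex.I * τ) / 2 = ((Real.pi / 2 * τ : ℝ) : ℂ) * Complex.I by
    push_cast; ring, Complex.sin_mul_I, ← Complex.ofReal_sinh, ← mul_integral_sin_mul_sinh_mul_sin,
    show Real.pi * τ = 2 * (Real.pi / 2 * τ) by ring, Real.sinh_two_mul]
  simp only [Complex.ofReal_mul, Complex.ofReal_ofNat]
  have := Complex.I_ne_zero
  generalize (Real.sinh (Real.pi / 2 * τ) : ℂ) = S at hs' ⊢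
  field_simp

theorem integral_macdonaldK_mul_besselKs {n m : ℕ} (hn : 1 ≤ n) :
    IntegrableOn (fun τ : ℝ => macdonaldK (Complex.I * τ) n *
          besselKs m (Complex.I * τ) (Real.arsinh Real.pi) *
          ((τ * Real.sinh (Real.pi * τ) : ℝ) : ℂ)) (Set.Ioi (0 : ℝ)) ∧
      ∫ τ in Set.Ioi (0 : ℝ), macdonaldK (Complex.I * τ) n *
          besselKs m (Complex.I * τ) (Real.arsinh Real.pi) *
          ((τ * Real.sinh (Real.pi * τ) : ℝ) : ℂ) =
        ((Real.pi ^ 2 * n / 2 * kroneckerDelta n m : ℝ) : ℂ) := by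
  have hw : 0 ≤ Real.arsinh Real.pi := Real.arsinh_nonneg_iff.2 Real.pi_pos.le
  have hn0 : (0 : ℝ) < n := by positivity
  have hd : ∀ u : ℝ, HasDerivAt (fun u => m * Real.cosh u * Real.cos (m * Real.sinh u))
      (m * Real.sinh u * Real.cos (m * Real.sinh u) +
        m * Real.cosh u * (-Real.sin (m * Real.sinh u) * (m * Real.cosh u))) u := fun u =>
    ((Real.hasDerivAt_cosh u).const_mul (m : ℝ)).mul
      ((Real.hasDerivAt_sinh u).const_mul (m : ℝ)).cos
  obtain ⟨M, hM⟩ := abs_integral_mul_cos_le hd (by fun_prop) hw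
  obtain ⟨h1, h2⟩ := integral_cosh_mul_macdonaldKIm_mul hn0 hw (by fun_prop) hM
  have key : ∀ τ ∈ Set.Ioi (0 : ℝ), macdonaldK (Complex.I * τ) n *
          besselKs m (Complex.I * τ) (Real.arsinh Real.pi) *
          ((τ * Real.sinh (Real.pi * τ) : ℝ) : ℂ) =
      ((2 * (Real.cosh (Real.pi / 2 * τ) * macdonaldKIm τ n * ∫ u in (0 : ℝ)..Real.arsinh Real.pi,
        (m * Real.cosh u * Real.cos (m * Real.sinh u)) * Real.cos (τ * u)) : ℝ) : ℂ) := by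
    intro τ hτ
    rw [mul_assoc, besselKs_I_mul_mul hτ, ← Complex.ofReal_natCast n, macdonaldK_I_mul,
      ← Complex.ofReal_mul]
    congr 1
    ring
  refine ⟨IntegrableOn.congr_fun (h1.const_mul 2).ofReal (fun τ hτ => (key τ hτ).symm)
    measurableSet_Ioi, ?_⟩
  rw [setIntegral_congr_fun measurableSet_Ioi key, integral_complex_ofReal, integral_const_mul, h2,
    Complex.ofReal_inj]
  -- The substitution `v = sinh u` carries `[0, arsinh π]` to `[0, π]`, where the cosines are
  -- orthogonal.
  have h3 := intervalIntegral.integral_comp_mul_deriv (a := 0) (b := Real.arsinh Real.pi)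
    (f := Real.sinh) (f' := Real.cosh) (g := fun v => Real.cos (m * v) * Real.cos (n * v))
    (fun u _ => Real.hasDerivAt_sinh u) (by fun_prop) (by fun_prop)
  rw [Real.sinh_zero, Real.sinh_arsinh, integral_cos_mul_cos_nat hn] at h3
  have h4 : ∀ u : ℝ, m * Real.cosh u * Real.cos (m * Real.sinh u) * Real.cos (n * Real.sinh u) =
      m * (((fun v => Real.cos (m * v) * Real.cos (n * v)) ∘ Real.sinh) u * Real.cosh u) :=
    fun u => by simp only [Function.comp_apply]; ring
  simp_rw [h4]
  rw [intervalIntegral.integral_const_mul, h3, kroneckerDelta]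
  split_ifs with e
  · subst e
    ring
  · simp

end

theorem lemma1 (n m : ℕ) (hn : 1 ≤ n) (hm : 1 ≤ m) :
    (IntegrableOn (fun x : ℝ => macdonaldK (Complex.I * n) x *
          besselJInc x (Complex.I * m) Real.pi / (x : ℂ)) (Set.Ioi (0 : ℝ)) ∧
      ∫ x in Set.Ioi (0 : ℝ), macdonaldK (Complex.I * n) x *
          besselJInc x (Complex.I * m) Real.pi / (x : ℂ) =
        ((Real.pi ^ 2 / 2 * (kroneckerDelta n m / (n * Real.sinh (Real.pi * n))) : ℝ) : ℂ)) ∧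
    (IntegrableOn (fun x : ℝ => macdonaldK (Complex.I * n) x *
          besselKc x (Complex.I * m) Real.pi / (x : ℂ)) (Set.Ioi (0 : ℝ)) ∧
      ∫ x in Set.Ioi (0 : ℝ), macdonaldK (Complex.I * n) x *
          besselKc x (Complex.I * m) Real.pi / (x : ℂ) =
        ((Real.pi ^ 2 / 2 * (kroneckerDelta n m / (n * Real.sinh (Real.pi * n))) : ℝ) : ℂ)) ∧
    (IntegrableOn (fun τ : ℝ => macdonaldK (Complex.I * τ) n *
          besselKs m (Complex.I * τ) (Real.arsinh Real.pi) *
          ((τ * Real.sinh (Real.pi * τ) : ℝ) : ℂ)) (Set.Ioi (0 : ℝ)) ∧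
      ∫ τ in Set.Ioi (0 : ℝ), macdonaldK (Complex.I * τ) n *
          besselKs m (Complex.I * τ) (Real.arsinh Real.pi) *
          ((τ * Real.sinh (Real.pi * τ) : ℝ) : ℂ) =
        ((Real.pi ^ 2 * n / 2 * kroneckerDelta n m : ℝ) : ℂ)) :=
  ⟨integral_macdonaldK_mul_besselJInc hn hm, integral_macdonaldK_mul_besselKc hn hm,
    integral_macdonaldK_mul_besselKs hn⟩
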